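/- **Proposition (Lax–Wendroff type convergence of the fully discrete scheme).** Let $0<\theta<1$, $q>1$, $L>0$, $I=(-L,L)$. Write $x^{r}:=|x|^{r-1}x$ for odd powers of real numbers, and $$(-\Delta)^\theta\varphi(x)=C_{1,\theta}\lim_{\varepsilon\to0^+}\int_{\mathbb R\setminus B_\varepsilon(x)}\frac{\varphi(x)-\varphi(y)}{|x-y|^{1+2\theta}}\,dy,\qquad C_{1,\theta}=\frac{2\theta\,2^{2\theta-1}\,\Gamma(\frac{1+2\theta}{2})}{\pi^{1/2}\,\Gamma(\frac{2-2\theta}{2})}.$$ For $h>0$ let $[(-\Delta)^\theta_h\mathbf f]_i=\sum_{j\in\mathbb Z}w^h_j(f_i-f_{i-j})$ with the symmetric Huang–Oberman weights $w^h_{-j}=w^h_j$ given by ($w^h_0$ is irrelevant, say $0$) $$w^h_j=h^{-2\theta}\begin{cases}\frac{C_{1,\theta}}{2-2\theta}-G''(1)-\frac{G'(3)+3G'(1)}2+G(3)-G(1),&j=1,\\ 2[G'(j+1)+G'(j-1)-G(j+1)+G(j-1)],&j=2,4,6,\dots\\ -\frac{G'(j+2)+6G'(j)+G'(j-2)}2+G(j+2)-G(j-2),&j=3,5,7,\dots\end{cases}$$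 where $G(t)=\frac{C_{1,\theta}}{(2-2\theta)(2\theta-1)2\theta}|t|^{2-2\theta}$ if $2\theta\ne1$ and $G(t)=C_{1,\theta}(t-t\log|t|)$ if $2\theta=1$. Call $(\Delta t,h)$ admissible if $\Delta t>0$, $h>0$ and $L=(M_x+1)h$ for some integer $M_x\ge1$. Let $D$ be a set of admissible pairs with $(0,0)\in\overline D$ (for instance the set of all admissible pairs); limits "as $(\Delta t,h)\to0$" are taken within $D$. For each $h$ occurring in $D$ let $\mathbf u^0=\mathbf u^0_h=(u^0_i)_{i\in\mathbb Z}$ be real numbers with $u_i^0=0$ for $|i|>M_x$, and for each $(\Delta t,h)\in D$ let $\mathbf u=(u^n_i)_{n\in\mathbb N,i\in\mathbb Z}$ be the solution of the scheme $$\frac{(u^{n+1}_i)^{q-1}-(u^n_i)^{q-1}}{\Delta t}+[(-\Delta)^\theta_h\mathbf u^{n+1}]_i=0\quad(|i|\le M_x,\ n\ge0),\qquad u^n_i=0\quad(|i|\ge M_x+1,\ n\ge0),$$ started from $\mathbf u^0_h$. Put $u_{\Delta t,h}(t,x)=u^n_i$ for $(t,x)\in[n\Delta t,(n+1)\Delta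 t)\times[ih-\frac h2,ih+\frac h2)$ and $u^0_h(x)=u^0_i$ for $x\in[ih-\frac h2,ih+\frac h2)$. Assume that * for every $T>0$, $\|u_{\Delta t,h}\|_{L^\infty((0,T)\times\mathbb R)}$ is bounded uniformly in $(\Delta t,h)\in D$; * there is $u\in L^\infty((0,\infty)\times\mathbb R)$ with $u_{\Delta t,h}\to u$ almost everywhere on $(0,\infty)\times\mathbb R$ as $(\Delta t,h)\to0$; * there is $u^0\in L^1(I)$ with $u^0_h\to u^0$ in $L^1(I)$ as $(\Delta t,h)\to0$. Then $u$ is a weak solution of the Cauchy–Dirichlet problem $\partial_tu^{q-1}+(-\Delta)^\theta u=0$ in $(0,\infty)\times I$, $u=0$ in $(0,\infty)\times(\mathbb R\setminus I)$, $u(0,\cdot)=u^0$ in $I$, for the restricted fractional Laplacian: for all $T>0$ and all $\varphi\in C_c^\infty([0,T)\times I)$ (restrictions to $t\ge0$ of functions in $C_c^\infty((-\infty,T)\times I)$), the integrands below are integrable and $$-\int_0^T\!\!\int_I u^{q-1}\,\partial_t\varphi\,dx\,dt+\int_0^T\!\!\int_I u\,(-\Delta)^\theta\varphi\,dx\,dt-\int_I(u^0)^{q-1}(x)\,\varphi(0,x)\,dx=0;$$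 moreover $u=0$ almost everywhere in $(0,\infty)\times(\mathbb R\setminus I)$. -/

import Mathlib

open MeasureTheory Set Filter Topology
open scoped ENNReal NNReal ContDiff

namespace FracDiffusion

/-- The odd (sign-preserving) power `x ^ r := |x| ^ (r - 1) * x`. -/
noncomputable def oddPow (r x : ℝ) : ℝ := |x| ^ (r - 1) * x

/-- The normalising constant `C_{1,θ}` of the fractional Laplacian in dimension one. -/
noncomputable def fracConst (θ : ℝ) : ℝ :=
  2 * θ * 2 ^ (2 * θ - 1) * Real.Gamma ((1 + 2 * θ) / 2) /
    (Real.sqrt Real.pi * Real.Gamma ((2 - 2 * θ) / 2))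

/-- The fractional Laplacian on the line as a principal value:
`C_{1,θ} lim_{ε → 0+} ∫_{ℝ \ B_ε(x)} (φ x - φ y) / |x - y| ^ (1 + 2θ) dy`. -/
noncomputable def fracLap (θ : ℝ) (φ : ℝ → ℝ) (x : ℝ) : ℝ :=
  fracConst θ * limUnder (𝓝[>] (0 : ℝ)) (fun ε : ℝ =>
    ∫ y in (Metric.ball x ε)ᶜ, (φ x - φ y) / |x - y| ^ (1 + 2 * θ))

/-- The function `G` entering the Huang–Oberman weights. -/
noncomputable def weightG (θ t : ℝ) : ℝ :=
  if 2 * θ = 1 then fracConst θ * (t - t * Real.log |t|)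
  else fracConst θ / ((2 - 2 * θ) * (2 * θ - 1) * (2 * θ)) * |t| ^ (2 - 2 * θ)

/-- The Huang–Oberman weights for `h = 1`, as a function of `k = |j|`.
The value at `k = 0` is irrelevant, since `w_0` always multiplies `f_i - f_i = 0`. -/
noncomputable def unitWeight (θ : ℝ) (k : ℕ) : ℝ :=
  if k = 0 then 0
  else if k = 1 then
    fracConst θ / (2 - 2 * θ) - deriv (deriv (weightG θ)) 1
      - (deriv (weightG θ) 3 + 3 * deriv (weightG θ) 1) / 2
      + weightG θ 3 - weightG θ 1
  else if Even k then
    2 * (deriv (weightG θ) ((k : ℝ) + 1) + deriv (weightG θ) ((k : ℝ) - 1)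
      - weightG θ ((k : ℝ) + 1) + weightG θ ((k : ℝ) - 1))
  else
    -(deriv (weightG θ) ((k : ℝ) + 2) + 6 * deriv (weightG θ) (k : ℝ)
      + deriv (weightG θ) ((k : ℝ) - 2)) / 2
      + weightG θ ((k : ℝ) + 2) - weightG θ ((k : ℝ) - 2)

/-- The symmetric Huang–Oberman weights `w_j^h`. -/
noncomputable def weight (θ h : ℝ) (j : ℤ) : ℝ := h ^ (-(2 * θ)) * unitWeight θ j.natAbs

/-- The discrete fractional Laplacian `[(-Δ)_h^θ f]_i = ∑_j w_j^h (f_i - f_{i-j})`. -/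
noncomputable def discFracLap (θ h : ℝ) (f : ℤ → ℝ) (i : ℤ) : ℝ :=
  ∑' j : ℤ, weight θ h j * (f i - f (i - j))

/-- `u = (u_i^n)` solves the fully discrete implicit Euler scheme with time step `Δt`, space step
`h`, interior nodes `|i| ≤ M` and initial datum `u0`. -/
structure IsFDSolution (θ q Δt h : ℝ) (M : ℕ) (u0 : ℤ → ℝ) (u : ℕ → ℤ → ℝ) : Prop where
  scheme : ∀ (n : ℕ) (i : ℤ), |i| ≤ (M : ℤ) →
    (oddPow (q - 1) (u (n + 1) i) - oddPow (q - 1) (u n i)) / Δt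
      + discFracLap θ h (u (n + 1)) i = 0
  exterior : ∀ (n : ℕ) (i : ℤ), (M : ℤ) + 1 ≤ |i| → u n i = 0
  initial : ∀ i : ℤ, |i| ≤ (M : ℤ) → u 0 i = u0 i

/-- Piecewise constant reconstruction in space: the value at `x` is `f i`, where `i` is the index
with `x ∈ [i h - h/2, i h + h/2)`. -/
noncomputable def spaceRecon (h : ℝ) (f : ℤ → ℝ) (x : ℝ) : ℝ := f ⌊x / h + 1 / 2⌋

/-- Piecewise constant reconstruction in time and space: the value at `(t, x)`, `t ≥ 0`, is
`u n i` where `t ∈ [n Δt, (n + 1) Δt)` and `x ∈ [i h - h/2, i h + h/2)`. -/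
noncomputable def recon (Δt h : ℝ) (u : ℕ → ℤ → ℝ) (p : ℝ × ℝ) : ℝ :=
  spaceRecon h (u ⌊p.1 / Δt⌋₊) p.2

theorem spaceRecon_eq {h x : ℝ} (hh : 0 < h) (f : ℤ → ℝ) (i : ℤ)
    (hx : x ∈ Ico (i * h - h / 2) (i * h + h / 2)) : spaceRecon h f x = f i := by
  have : ⌊x / h + 1 / 2⌋ = i := by
    obtain ⟨h1, h2⟩ := hx
    rw [Int.floor_eq_iff]
    constructor
    · have : (i : ℝ) - 1 / 2 ≤ x / h := by
        rw [le_div_iff₀ hh]; linarith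
      linarith
    · have : x / h < (i : ℝ) + 1 / 2 := by
        rw [div_lt_iff₀ hh]; linarith
      linarith
  rw [spaceRecon, this]

theorem recon_eq {Δt h t x : ℝ} (hΔt : 0 < Δt) (hh : 0 < h) (u : ℕ → ℤ → ℝ) (n : ℕ) (i : ℤ)
    (ht : t ∈ Ico (n * Δt) ((n + 1) * Δt))
    (hx : x ∈ Ico (i * h - h / 2) (i * h + h / 2)) : recon Δt h u (t, x) = u n i := by
  have : ⌊t / Δt⌋₊ = n := by
    obtain ⟨h1, h2⟩ := ht
    have h0 : (0 : ℝ) ≤ t / Δt := div_nonneg (le_trans (by positivity) h1) hΔt.le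
    rw [Nat.floor_eq_iff h0]
    exact ⟨by rwa [le_div_iff₀ hΔt], by rwa [div_lt_iff₀ hΔt]⟩
  simp only [recon, this]
  exact spaceRecon_eq hh _ i hx

/-- Test functions in `C_c^∞([0, T) × (-L, L))`: restrictions to `t ≥ 0` of smooth functions with
compact support in `(-∞, T) × (-L, L)`. They need not vanish at `t = 0`. -/
structure IsTestFunction (L T : ℝ) (φ : ℝ → ℝ → ℝ) : Prop where
  smooth : ContDiff ℝ ∞ (Function.uncurry φ)
  compact : HasCompactSupport (Function.uncurry φ)
  supp : tsupport (Function.uncurry φ) ⊆ Iio T ×ˢ Ioo (-L) L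

/-- `u` is a weak solution on `(0, ∞) × (-L, L)` of `∂_t u^{q-1} + (-Δ)^θ u = 0` with initial
datum `u0`: for all `T > 0` and all test functions the three integrals exist and the weak
formulation holds. -/
def IsWeakSolution (θ q L : ℝ) (u0 : ℝ → ℝ) (u : ℝ → ℝ → ℝ) : Prop :=
  ∀ T : ℝ, 0 < T → ∀ φ : ℝ → ℝ → ℝ, IsTestFunction L T φ →
    IntegrableOn (fun p : ℝ × ℝ => oddPow (q - 1) (u p.1 p.2) * deriv (fun s => φ s p.2) p.1)
      (Ioo 0 T ×ˢ Ioo (-L) L) ∧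
    IntegrableOn (fun p : ℝ × ℝ => u p.1 p.2 * fracLap θ (φ p.1) p.2)
      (Ioo 0 T ×ˢ Ioo (-L) L) ∧
    IntegrableOn (fun x : ℝ => oddPow (q - 1) (u0 x) * φ 0 x) (Ioo (-L) L) ∧
    -(∫ t in Ioo 0 T, ∫ x in Ioo (-L) L, oddPow (q - 1) (u t x) * deriv (fun s => φ s x) t)
      + (∫ t in Ioo 0 T, ∫ x in Ioo (-L) L, u t x * fracLap θ (φ t) x)
      - (∫ x in Ioo (-L) L, oddPow (q - 1) (u0 x) * φ 0 x) = 0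

end FracDiffusion

/-! Test the scheme with the grid values of `φ` and move both discrete operators onto `φ`: the time
difference by Abel summation, the discrete Laplacian by symmetry of the weights
(`IsFDSolution.sum_eq`). After multiplication by `Δt * h` this is an identity between integrals of
piecewise constant functions (`IsFDSolution.integral_eq`). Because the scheme is implicit, an extra
term `Δt ∫ u⁰ (-Δ)_h φ(0)` appears; it vanishes in the limit. In the other terms `u` enters only
through a bounded, almost everywhere convergent family and a continuous power, so dominated
convergence applies once the operators acting on `φ` are known to be bounded and consistent.

The core is therefore consistency of the discrete Laplacian at moving grid points
(`IsRegularFamily.tendsto_discFracLap`). The function `G` satisfies `G''' = C y^{-1-2θ}`, so the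
weights are exactly the integrals of a piecewise quadratic interpolation basis against this density.
Pairing `j` with `-j`, the discrete Laplacian becomes the integral of the interpolated second
difference of `φ` (`discFracLap_eq_integral`), just as the principal value is the integral of the
second difference itself (`fracLap_eq_integral`). Both integrands are dominated by a multiple of
`min 1 (y²) y^{-1-2θ}`, which is integrable, and the interpolant converges pointwise. No sign of the
weights is needed, only their absolute summability. -/

namespace FracDiffusion

/-! ### The density `c |y|^{-1-2θ}` and its third antiderivative `G` -/

/-- The density of the Lévy measure of `(-Δ)^θ` on the positive half line. -/
noncomputable def levyDensity (θ y : ℝ) : ℝ := fracConst θ * y ^ (-(1 + 2 * θ))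

lemma hasDerivAt_weightG {θ t : ℝ} (hθ0 : 0 < θ) (hθ1 : θ < 1) (ht : 0 < t) :
    HasDerivAt (weightG θ)
      (if 2 * θ = 1 then -(fracConst θ * Real.log t)
        else fracConst θ / ((2 * θ - 1) * (2 * θ)) * t ^ (1 - 2 * θ)) t := by
  have habs : (fun s : ℝ => |s|) =ᶠ[𝓝 t] fun s => s := by
    filter_upwards [lt_mem_nhds ht] with s hs using abs_of_pos hs
  split_ifs with h
  · have h1 : HasDerivAt (fun s : ℝ => fracConst θ * (s - s * Real.log s))
        (fracConst θ * (1 - (1 * Real.log t + t * t⁻¹))) t :=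
      ((hasDerivAt_id t).sub ((hasDerivAt_id t).mul (Real.hasDerivAt_log ht.ne'))).const_mul _
    rw [mul_inv_cancel₀ ht.ne'] at h1
    refine (h1.congr_deriv (by ring)).congr_of_eventuallyEq ?_
    · filter_upwards [habs] with s hs
      simp only [weightG, if_pos h, hs]
  · have h2 : (2 * θ - 1) ≠ 0 := fun h' => h (by linarith)
    have h3 : (2 - 2 * θ) ≠ 0 := by linarith
    have h4 : (1 - θ) ≠ 0 := by linarith
    have h1 := (Real.hasDerivAt_rpow_const (x := t) (p := 2 - 2 * θ) (Or.inl ht.ne')).const_mul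
      (fracConst θ / ((2 - 2 * θ) * (2 * θ - 1) * (2 * θ)))
    refine (h1.congr_deriv ?_).congr_of_eventuallyEq ?_
    · rw [show 2 - 2 * θ - 1 = 1 - 2 * θ by ring]
      field_simp
    · filter_upwards [habs] with s hs
      simp only [weightG, if_neg h, hs]

lemma hasDerivAt_deriv_weightG {θ t : ℝ} (hθ0 : 0 < θ) (hθ1 : θ < 1) (ht : 0 < t) :
    HasDerivAt (deriv (weightG θ)) (-(fracConst θ / (2 * θ)) * t ^ (-(2 * θ))) t := by
  have hev : deriv (weightG θ) =ᶠ[𝓝 t] fun s => if 2 * θ = 1 then -(fracConst θ * Real.log s)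
        else fracConst θ / ((2 * θ - 1) * (2 * θ)) * s ^ (1 - 2 * θ) := by
    filter_upwards [lt_mem_nhds ht] with s hs using (hasDerivAt_weightG hθ0 hθ1 hs).deriv
  refine HasDerivAt.congr_of_eventuallyEq ?_ hev
  split_ifs with h
  · refine ((Real.hasDerivAt_log ht.ne').const_mul (fracConst θ)).neg.congr_deriv ?_
    rw [h, Real.rpow_neg_one]
    ring
  · have h2 : (2 * θ - 1) ≠ 0 := fun h' => h (by linarith)
    refine ((Real.hasDerivAt_rpow_const (x := t) (p := 1 - 2 * θ) (Or.inl ht.ne')).const_mul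
      (fracConst θ / ((2 * θ - 1) * (2 * θ)))).congr_deriv ?_
    rw [show 1 - 2 * θ - 1 = -(2 * θ) by ring]
    field_simp
    ring

lemma hasDerivAt_deriv_deriv_weightG {θ t : ℝ} (hθ0 : 0 < θ) (hθ1 : θ < 1) (ht : 0 < t) :
    HasDerivAt (deriv (deriv (weightG θ))) (levyDensity θ t) t := by
  have hev : deriv (deriv (weightG θ)) =ᶠ[𝓝 t]
      fun s => -(fracConst θ / (2 * θ)) * s ^ (-(2 * θ)) := by
    filter_upwards [lt_mem_nhds ht] with s hs using (hasDerivAt_deriv_weightG hθ0 hθ1 hs).deriv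
  refine HasDerivAt.congr_of_eventuallyEq ?_ hev
  refine ((Real.hasDerivAt_rpow_const (x := t) (p := -(2 * θ)) (Or.inl ht.ne')).const_mul
      (-(fracConst θ / (2 * θ)))).congr_deriv ?_
  rw [levyDensity, show -(2 * θ) - 1 = -(1 + 2 * θ) by ring]
  field_simp

lemma continuousOn_levyDensity (θ : ℝ) : ContinuousOn (levyDensity θ) (Ioi 0) := by
  intro t ht
  exact ((Real.continuousAt_rpow_const t _ (Or.inl (ne_of_gt ht))).const_mul
    _).continuousWithinAt

lemma measurable_levyDensity (θ : ℝ) : Measurable (levyDensity θ) := by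
  unfold levyDensity
  fun_prop

lemma intervalIntegrable_mul_levyDensity {θ p r : ℝ} (hp : 0 < p) (hpr : p ≤ r) {P : ℝ → ℝ}
    (hP : Continuous P) : IntervalIntegrable (fun y => P y * levyDensity θ y) volume p r := by
  apply ContinuousOn.intervalIntegrable
  rw [uIcc_of_le hpr]
  exact hP.continuousOn.mul ((continuousOn_levyDensity θ).mono fun y hy => hp.trans_le hy.1)

/-- Repeated integration by parts: for a quadratic `P`, the product `P G'''` has antiderivative `P
G'' - P' G' + P'' G`. This is where the values and derivatives of `G` in the weights come from. -/
lemma integral_quadratic_mul_levyDensity {θ p r : ℝ} (hθ0 : 0 < θ) (hθ1 : θ < 1) (hp : 0 < p)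
    (hpr : p ≤ r) (α β γ m : ℝ) :
    ∫ y in p..r, (α * (y - m) ^ 2 + β * (y - m) + γ) * levyDensity θ y =
      ((α * (r - m) ^ 2 + β * (r - m) + γ) * deriv (deriv (weightG θ)) r
        - (2 * α * (r - m) + β) * deriv (weightG θ) r + 2 * α * weightG θ r)
      - ((α * (p - m) ^ 2 + β * (p - m) + γ) * deriv (deriv (weightG θ)) p
        - (2 * α * (p - m) + β) * deriv (weightG θ) p + 2 * α * weightG θ p) := by
  rw [intervalIntegral.integral_eq_sub_of_hasDerivAt
    (f := fun y => (α * (y - m) ^ 2 + β * (y - m) + γ) * deriv (deriv (weightG θ)) y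
        - (2 * α * (y - m) + β) * deriv (weightG θ) y + 2 * α * weightG θ y)]
  · intro y hy
    rw [uIcc_of_le hpr] at hy
    have hy0 : 0 < y := hp.trans_le hy.1
    have d0 := hasDerivAt_weightG hθ0 hθ1 hy0
    rw [← d0.deriv] at d0
    have d1 := hasDerivAt_deriv_weightG hθ0 hθ1 hy0
    rw [← d1.deriv] at d1
    have d2 := hasDerivAt_deriv_deriv_weightG hθ0 hθ1 hy0
    have e : HasDerivAt (fun y : ℝ => y - m) 1 y := (hasDerivAt_id y).sub_const m
    have q2 : HasDerivAt (fun y => α * (y - m) ^ 2 + β * (y - m) + γ)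
        (2 * α * (y - m) + β) y := by
      refine ((((e.pow 2).const_mul α).add (e.const_mul β)).add_const γ).congr_deriv ?_
      norm_num
      ring
    have q1 : HasDerivAt (fun y => 2 * α * (y - m) + β) (2 * α) y := by
      exact ((e.const_mul (2 * α)).add_const β).congr_deriv (by ring)
    exact (((q2.mul d2).sub (q1.mul d1)).add (d0.const_mul (2 * α))).congr_deriv (by ring)
  · exact intervalIntegrable_mul_levyDensity hp hpr (by fun_prop)

/-! ### Integrability against the Lévy density -/

lemma integrableOn_levyDensity_Ioi_one {θ : ℝ} (hθ0 : 0 < θ) :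
    IntegrableOn (levyDensity θ) (Ioi 1) :=
  (integrableOn_Ioi_rpow_of_lt (by linarith) one_pos).const_mul _

/-- Near zero the exponent is `1 - 2θ > -1`, at infinity it is `-(1 + 2θ) < -1`. This is the
majorant behind every dominated convergence argument in `y`. -/
lemma integrableOn_min_mul_rpow {θ : ℝ} (hθ0 : 0 < θ) (hθ1 : θ < 1) :
    IntegrableOn (fun y : ℝ => min 1 (y ^ 2) * y ^ (-(1 + 2 * θ))) (Ioi 0) := by
  rw [← Ioc_union_Ioi_eq_Ioi zero_le_one, integrableOn_union]
  constructor
  · have h1 : IntegrableOn (fun y : ℝ => y ^ (1 - 2 * θ)) (Ioc 0 1) := by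
      have := intervalIntegral.intervalIntegrable_rpow' (a := 0) (b := 1) (r := 1 - 2 * θ)
        (by linarith)
      rwa [intervalIntegrable_iff_integrableOn_Ioc_of_le zero_le_one] at this
    refine h1.congr_fun (fun y hy => ?_) measurableSet_Ioc
    have h2 : y ^ 2 ≤ 1 := pow_le_one₀ hy.1.le hy.2
    simp only [min_eq_right h2]
    rw [show (1 - 2 * θ) = 2 + -(1 + 2 * θ) by ring, Real.rpow_add hy.1, Real.rpow_two]
  · have h1 : IntegrableOn (fun y : ℝ => y ^ (-(1 + 2 * θ))) (Ioi 1) :=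
      integrableOn_Ioi_rpow_of_lt (by linarith) one_pos
    refine h1.congr_fun (fun y hy => ?_) measurableSet_Ioi
    have h2 : 1 ≤ y ^ 2 := one_le_pow₀ (le_of_lt hy)
    simp only [min_eq_left h2, one_mul]

lemma integrableOn_mul_rpow {θ : ℝ} (hθ0 : 0 < θ) (hθ1 : θ < 1) {F : ℝ → ℝ} {B : ℝ}
    (hF : Measurable F) (hb : ∀ y, 0 < y → |F y| ≤ B * min 1 (y ^ 2)) :
    IntegrableOn (fun y : ℝ => F y * y ^ (-(1 + 2 * θ))) (Ioi 0) := by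
  refine Integrable.mono' ((integrableOn_min_mul_rpow hθ0 hθ1).const_mul B)
    (hF.mul (by fun_prop)).aestronglyMeasurable ?_
  refine (ae_restrict_mem measurableSet_Ioi).mono fun y hy => ?_
  rw [Real.norm_eq_abs, abs_mul, ← mul_assoc, abs_of_nonneg (Real.rpow_nonneg (le_of_lt hy) _)]
  exact mul_le_mul_of_nonneg_right (hb y hy) (Real.rpow_nonneg (le_of_lt hy) _)

lemma integrableOn_mul_levyDensity {θ : ℝ} (hθ0 : 0 < θ) (hθ1 : θ < 1) {F : ℝ → ℝ} {B : ℝ}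
    (hF : Measurable F) (hb : ∀ y, 0 < y → |F y| ≤ B * min 1 (y ^ 2)) :
    IntegrableOn (fun y => F y * levyDensity θ y) (Ioi 0) := by
  have h : IntegrableOn (fun y => fracConst θ * (F y * y ^ (-(1 + 2 * θ)))) (Ioi 0) :=
    (integrableOn_mul_rpow hθ0 hθ1 hF hb).const_mul (fracConst θ)
  refine h.congr_fun (fun y _ => ?_) measurableSet_Ioi
  simp only [levyDensity]
  ring

lemma integral_sq_mul_levyDensity {θ : ℝ} (hθ1 : θ < 1) :
    ∫ y in (0 : ℝ)..1, y ^ 2 * levyDensity θ y = fracConst θ / (2 - 2 * θ) := by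
  have h1 : ∫ y in (0 : ℝ)..1, y ^ 2 * levyDensity θ y
      = ∫ y in (0 : ℝ)..1, fracConst θ * y ^ (1 - 2 * θ) := by
    rw [intervalIntegral.integral_of_le zero_le_one, intervalIntegral.integral_of_le zero_le_one]
    refine setIntegral_congr_fun measurableSet_Ioc fun y hy => ?_
    simp only [levyDensity]
    rw [show (1 - 2 * θ) = 2 + -(1 + 2 * θ) by ring, Real.rpow_add hy.1, Real.rpow_two]
    ring
  rw [h1, intervalIntegral.integral_const_mul, integral_rpow (Or.inl (by linarith)),
    show 1 - 2 * θ + 1 = 2 - 2 * θ by ring, Real.one_rpow, Real.zero_rpow (by linarith)]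
  ring

/-! ### Quadratic interpolation -/

/-- The interpolant behind the Huang–Oberman weights: `g 1 * y ^ 2` on `(0, 1]`, and on
`(2 m - 1, 2 m + 1]` the quadratic polynomial through the nodes `2 m - 1`, `2 m`, `2 m + 1`. -/
noncomputable def interp (g : ℕ → ℝ) (y : ℝ) : ℝ :=
  if y ≤ 1 then g 1 * y ^ 2
  else
    (y - 2 * ⌈(y - 1) / 2⌉₊) * (y - 2 * ⌈(y - 1) / 2⌉₊ - 1) / 2 * g (2 * ⌈(y - 1) / 2⌉₊ - 1)
      + (1 - (y - 2 * ⌈(y - 1) / 2⌉₊) ^ 2) * g (2 * ⌈(y - 1) / 2⌉₊)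
      + (y - 2 * ⌈(y - 1) / 2⌉₊) * (y - 2 * ⌈(y - 1) / 2⌉₊ + 1) / 2 * g (2 * ⌈(y - 1) / 2⌉₊ + 1)

lemma measurable_interp (g : ℕ → ℝ) : Measurable (interp g) := by
  have hc : Measurable fun y : ℝ => ⌈(y - 1) / 2⌉₊ :=
    Nat.measurable_ceil.comp (by fun_prop)
  have hg : ∀ f : ℕ → ℝ, Measurable fun y : ℝ => f ⌈(y - 1) / 2⌉₊ := fun f =>
    (measurable_of_countable f).comp hc
  have h0 := hg fun n => (n : ℝ)
  have h1 := hg fun n => g (2 * n - 1)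
  have h2 := hg fun n => g (2 * n)
  have h3 := hg fun n => g (2 * n + 1)
  refine Measurable.ite measurableSet_Iic (by fun_prop) ?_
  fun_prop

lemma interp_of_le_one (g : ℕ → ℝ) {y : ℝ} (hy : y ≤ 1) : interp g y = g 1 * y ^ 2 := by
  simp [interp, hy]

lemma interp_of_mem_Ioc (g : ℕ → ℝ) {y : ℝ} {m : ℕ}
    (hy : y ∈ Ioc (2 * (m : ℝ) + 1) (2 * m + 3)) :
    interp g y = (y - (2 * m + 2)) * (y - (2 * m + 2) - 1) / 2 * g (2 * m + 1)
      + (1 - (y - (2 * m + 2)) ^ 2) * g (2 * m + 2)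
      + (y - (2 * m + 2)) * (y - (2 * m + 2) + 1) / 2 * g (2 * m + 3) := by
  obtain ⟨h1, h2⟩ := hy
  have hm : (0 : ℝ) ≤ m := m.cast_nonneg
  have hc : ⌈(y - 1) / 2⌉₊ = m + 1 := by
    rw [Nat.ceil_eq_iff (by omega)]
    push_cast
    constructor <;> linarith
  rw [interp, if_neg (by linarith), hc, show 2 * (m + 1) - 1 = 2 * m + 1 by omega,
    show 2 * (m + 1) = 2 * m + 2 by omega]
  push_cast
  ring_nf

lemma exists_mem_Ioc_of_one_lt {y : ℝ} (hy : 1 < y) :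
    ∃ m : ℕ, y ∈ Ioc (2 * (m : ℝ) + 1) (2 * m + 3) := by
  have hc : ⌈(y - 1) / 2⌉₊ ≠ 0 := by
    rw [← Nat.pos_iff_ne_zero, Nat.ceil_pos]
    linarith
  obtain ⟨m, hm⟩ := Nat.exists_eq_succ_of_ne_zero hc
  have := (Nat.ceil_eq_iff hc).1 rfl
  rw [hm] at this
  simp only [Nat.succ_eq_add_one, add_tsub_cancel_right] at this
  push_cast at this
  exact ⟨m, by constructor <;> linarith [this.1, this.2]⟩

/-- The interpolant deviates from `c` by at most the sum of the deviations at the nodes. -/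
lemma abs_interp_sub_le (g : ℕ → ℝ) (c : ℝ) {y : ℝ} {m : ℕ}
    (hy : y ∈ Ioc (2 * (m : ℝ) + 1) (2 * m + 3)) :
    |interp g y - c| ≤ |g (2 * m + 1) - c| + |g (2 * m + 2) - c| + |g (2 * m + 3) - c| := by
  rw [interp_of_mem_Ioc g hy]
  obtain ⟨s, hs⟩ : ∃ s, s = y - (2 * (m : ℝ) + 2) := ⟨_, rfl⟩
  rw [← hs]
  have h1 : -1 ≤ s := by linarith [hy.1]
  have h2 : s ≤ 1 := by linarith [hy.2]
  -- The three Lagrange basis polynomials sum to 1, so `c` can be distributed over the nodes; each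
  -- of them is at most 1 in absolute value on `[-1, 1]`.
  have e : s * (s - 1) / 2 * g (2 * m + 1) + (1 - s ^ 2) * g (2 * m + 2)
      + s * (s + 1) / 2 * g (2 * m + 3) - c
      = s * (s - 1) / 2 * (g (2 * m + 1) - c) + (1 - s ^ 2) * (g (2 * m + 2) - c)
      + s * (s + 1) / 2 * (g (2 * m + 3) - c) := by ring
  have b1 : |s * (s - 1) / 2| ≤ 1 := by rw [abs_le]; constructor <;> nlinarith
  have b2 : |1 - s ^ 2| ≤ 1 := by rw [abs_le]; constructor <;> nlinarith
  have b3 : |s * (s + 1) / 2| ≤ 1 := by rw [abs_le]; constructor <;> nlinarith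
  rw [e]
  refine (abs_add_three _ _ _).trans ?_
  simp only [abs_mul (_ / _), abs_mul (1 - s ^ 2)]
  gcongr <;> exact mul_le_of_le_one_left (abs_nonneg _) (by assumption)

lemma abs_interp_le {g : ℕ → ℝ} {B : ℝ} (hg : ∀ n, |g n| ≤ B) (y : ℝ) (hy : 0 < y) :
    |interp g y| ≤ 3 * B * min 1 (y ^ 2) := by
  have hB : 0 ≤ B := (abs_nonneg _).trans (hg 0)
  rcases le_or_gt y 1 with h | h
  · rw [interp_of_le_one g h, min_eq_right (pow_le_one₀ hy.le h), abs_mul,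
      abs_of_nonneg (sq_nonneg y)]
    have := hg 1
    gcongr
    linarith
  · obtain ⟨m, hm⟩ := exists_mem_Ioc_of_one_lt h
    rw [min_eq_left (one_le_pow₀ h.le)]
    have := abs_interp_sub_le g 0 hm
    simp only [sub_zero] at this
    linarith [hg (2 * m + 1), hg (2 * m + 2), hg (2 * m + 3)]

lemma integrableOn_interp_mul_levyDensity {θ : ℝ} (hθ0 : 0 < θ) (hθ1 : θ < 1) {g : ℕ → ℝ} {B : ℝ}
    (hg : ∀ n, |g n| ≤ B) :
    IntegrableOn (fun y => interp g y * levyDensity θ y) (Ioi 0) :=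
  integrableOn_mul_levyDensity hθ0 hθ1 (measurable_interp g) (abs_interp_le hg)

/-! ### The weights as integrals of the interpolation basis -/

/-- Contribution of the left node to the integral over `(2 m + 1, 2 m + 3]`. -/
noncomputable def leftWeight (θ : ℝ) (m : ℕ) : ℝ :=
  ∫ y in (2 * (m : ℝ) + 1)..(2 * m + 3),
    (1 / 2 * (y - (2 * m + 2)) ^ 2 + -1 / 2 * (y - (2 * m + 2)) + 0) * levyDensity θ y

/-- Contribution of the middle node to the integral over `(2 m + 1, 2 m + 3]`. -/
noncomputable def midWeight (θ : ℝ) (m : ℕ) : ℝ :=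
  ∫ y in (2 * (m : ℝ) + 1)..(2 * m + 3),
    (-1 * (y - (2 * m + 2)) ^ 2 + 0 * (y - (2 * m + 2)) + 1) * levyDensity θ y

/-- Contribution of the right node to the integral over `(2 m + 1, 2 m + 3]`. -/
noncomputable def rightWeight (θ : ℝ) (m : ℕ) : ℝ :=
  ∫ y in (2 * (m : ℝ) + 1)..(2 * m + 3),
    (1 / 2 * (y - (2 * m + 2)) ^ 2 + 1 / 2 * (y - (2 * m + 2)) + 0) * levyDensity θ y

lemma unitWeight_zero (θ : ℝ) : unitWeight θ 0 = 0 := by simp [unitWeight]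

/-- Node 1 carries `∫₀¹ y² C y^{-1-2θ} dy = C / (2 - 2θ)` from the innermost panel and the left
basis function of the next one. That function equals 1 at `y = 1`, hence the term `-G''(1)`. -/
lemma unitWeight_one {θ : ℝ} (hθ0 : 0 < θ) (hθ1 : θ < 1) :
    unitWeight θ 1 = fracConst θ / (2 - 2 * θ) + leftWeight θ 0 := by
  rw [leftWeight, integral_quadratic_mul_levyDensity hθ0 hθ1 (by positivity) (by linarith)]
  norm_num [unitWeight]
  ring

/-- The middle basis function vanishes at both ends of its panel, so no `G''` survives. -/
lemma unitWeight_even {θ : ℝ} (hθ0 : 0 < θ) (hθ1 : θ < 1) (m : ℕ) :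
    unitWeight θ (2 * m + 2) = midWeight θ m := by
  rw [midWeight, integral_quadratic_mul_levyDensity hθ0 hθ1 (by positivity) (by linarith),
    unitWeight, if_neg (by omega), if_neg (by omega), if_pos ⟨m + 1, by omega⟩]
  push_cast
  rw [show 2 * (m : ℝ) + 2 + 1 = 2 * m + 3 by ring, show 2 * (m : ℝ) + 2 - 1 = 2 * m + 1 by ring]
  ring

/-- An odd node is shared by two panels. Both basis functions equal 1 there and vanish at the far
ends, so the two `G''` terms cancel. -/
lemma unitWeight_odd {θ : ℝ} (hθ0 : 0 < θ) (hθ1 : θ < 1) (m : ℕ) :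
    unitWeight θ (2 * m + 3) = rightWeight θ m + leftWeight θ (m + 1) := by
  rw [leftWeight, rightWeight,
    integral_quadratic_mul_levyDensity hθ0 hθ1 (by positivity) (by linarith),
    integral_quadratic_mul_levyDensity hθ0 hθ1 (by positivity) (by linarith),
    unitWeight, if_neg (by omega), if_neg (by omega),
    if_neg (by rw [Nat.not_even_iff_odd]; exact ⟨m + 1, by omega⟩)]
  push_cast
  rw [show 2 * (m : ℝ) + 3 + 2 = 2 * m + 5 by ring, show 2 * (m : ℝ) + 3 - 2 = 2 * m + 1 by ring,
    show 2 * ((m : ℝ) + 1) + 1 = 2 * m + 3 by ring, show 2 * ((m : ℝ) + 1) + 3 = 2 * m + 5 by ring]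
  ring

lemma integral_interp_mul_levyDensity_Ioc {θ : ℝ} (g : ℕ → ℝ) (m : ℕ) :
    ∫ y in (2 * (m : ℝ) + 1)..(2 * m + 3), interp g y * levyDensity θ y
      = leftWeight θ m * g (2 * m + 1) + midWeight θ m * g (2 * m + 2)
        + rightWeight θ m * g (2 * m + 3) := by
  have hp : (0 : ℝ) < 2 * m + 1 := by positivity
  have hpr : 2 * (m : ℝ) + 1 ≤ 2 * m + 3 := by linarith
  rw [leftWeight, midWeight, rightWeight, ← intervalIntegral.integral_mul_const,
    ← intervalIntegral.integral_mul_const, ← intervalIntegral.integral_mul_const,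
    ← intervalIntegral.integral_add, ← intervalIntegral.integral_add]
  · rw [intervalIntegral.integral_of_le hpr, intervalIntegral.integral_of_le hpr]
    refine setIntegral_congr_fun measurableSet_Ioc fun y hy => ?_
    simp only [interp_of_mem_Ioc g hy]
    ring
  · exact ((intervalIntegrable_mul_levyDensity hp hpr (by fun_prop)).mul_const _).add
      ((intervalIntegrable_mul_levyDensity hp hpr (by fun_prop)).mul_const _)
  · exact (intervalIntegrable_mul_levyDensity hp hpr (by fun_prop)).mul_const _
  · exact (intervalIntegrable_mul_levyDensity hp hpr (by fun_prop)).mul_const _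
  · exact (intervalIntegrable_mul_levyDensity hp hpr (by fun_prop)).mul_const _

/-- The full weight of the last node `2 N + 1` includes a contribution from the panel beyond the
cut-off; the subtracted term removes it, and it tends to zero as `N` grows. -/
lemma integral_interp_mul_levyDensity_eq_sum {θ : ℝ} (hθ0 : 0 < θ) (hθ1 : θ < 1) {g : ℕ → ℝ} {B : ℝ}
    (hg : ∀ n, |g n| ≤ B) (N : ℕ) :
    ∫ y in (0 : ℝ)..(2 * N + 1), interp g y * levyDensity θ y
      = ∑ j ∈ Finset.range (2 * N + 2), unitWeight θ j * g j
        - leftWeight θ N * g (2 * N + 1) := by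
  have hint : ∀ a b : ℝ, 0 ≤ a → a ≤ b →
      IntervalIntegrable (fun y => interp g y * levyDensity θ y) volume a b := by
    intro a b ha hab
    rw [intervalIntegrable_iff_integrableOn_Ioc_of_le hab]
    exact (integrableOn_interp_mul_levyDensity hθ0 hθ1 hg).mono_set
      (Ioc_subset_Ioi_self.trans (Ioi_subset_Ioi ha))
  induction N with
  | zero =>
    have h1 : ∫ y in (0 : ℝ)..1, interp g y * levyDensity θ y
        = g 1 * (fracConst θ / (2 - 2 * θ)) := by
      rw [← integral_sq_mul_levyDensity hθ1, ← intervalIntegral.integral_const_mul,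
        intervalIntegral.integral_of_le zero_le_one, intervalIntegral.integral_of_le zero_le_one]
      refine setIntegral_congr_fun measurableSet_Ioc fun y hy => ?_
      simp only [interp_of_le_one g hy.2]
      ring
    norm_num [Finset.sum_range_succ, unitWeight_zero, h1, unitWeight_one hθ0 hθ1]
    ring
  | succ N ih =>
    push_cast
    rw [show 2 * ((N : ℝ) + 1) + 1 = 2 * N + 3 by ring,
      ← intervalIntegral.integral_add_adjacent_intervals (b := 2 * (N : ℝ) + 1)
        (hint _ _ le_rfl (by positivity)) (hint _ _ (by positivity) (by linarith)), ih,
      integral_interp_mul_levyDensity_Ioc, show 2 * (N + 1) + 2 = 2 * N + 2 + 1 + 1 by ring,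
      Finset.sum_range_succ _ (2 * N + 2 + 1), Finset.sum_range_succ _ (2 * N + 2),
      unitWeight_even hθ0 hθ1, unitWeight_odd hθ0 hθ1, show 2 * (N + 1) + 1 = 2 * N + 3 by ring]
    ring

/-- The panels tile `(1, ∞)`, where the density is integrable. The absolute value avoids deciding
the sign of `fracConst θ`. -/
lemma summable_integral_abs_levyDensity {θ : ℝ} (hθ0 : 0 < θ) :
    Summable fun m : ℕ => ∫ y in (2 * (m : ℝ) + 1)..(2 * m + 3), |levyDensity θ y| := by
  have hI : IntegrableOn (fun y => |levyDensity θ y|) (Ioi 1) :=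
    (integrableOn_levyDensity_Ioi_one hθ0).abs
  refine summable_of_sum_range_le (c := ∫ y in Ioi (1 : ℝ), |levyDensity θ y|) (fun m =>
    intervalIntegral.integral_nonneg (by linarith) fun y _ => abs_nonneg _) fun n => ?_
  have h := intervalIntegral.sum_integral_adjacent_intervals (μ := volume) (n := n)
    (f := fun y => |levyDensity θ y|) (a := fun k : ℕ => 2 * (k : ℝ) + 1) (fun k _ => by
      rw [intervalIntegrable_iff_integrableOn_Ioc_of_le (by push_cast; linarith)]
      refine hI.mono_set (Ioc_subset_Ioi_self.trans (Ioi_subset_Ioi ?_))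
      linarith [k.cast_nonneg (α := ℝ)])
  have e : ∀ k : ℕ, 2 * ((k + 1 : ℕ) : ℝ) + 1 = 2 * k + 3 := fun k => by push_cast; ring
  simp only [e] at h
  rw [h]
  norm_num
  rw [intervalIntegral.integral_of_le (by linarith [n.cast_nonneg (α := ℝ)])]
  exact setIntegral_mono_set hI (ae_of_all _ fun y => abs_nonneg _)
    Ioc_subset_Ioi_self.eventuallyLE

lemma abs_integral_quadratic_le {θ : ℝ} (m : ℕ) {α β γ : ℝ}
    (hb : ∀ s : ℝ, -1 ≤ s → s ≤ 1 → |α * s ^ 2 + β * s + γ| ≤ 1) :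
    |∫ y in (2 * (m : ℝ) + 1)..(2 * m + 3),
      (α * (y - (2 * m + 2)) ^ 2 + β * (y - (2 * m + 2)) + γ) * levyDensity θ y|
      ≤ ∫ y in (2 * (m : ℝ) + 1)..(2 * m + 3), |levyDensity θ y| := by
  have hp : (0 : ℝ) < 2 * m + 1 := by positivity
  have hpr : 2 * (m : ℝ) + 1 ≤ 2 * m + 3 := by linarith
  refine (intervalIntegral.abs_integral_le_integral_abs hpr).trans
    (intervalIntegral.integral_mono_on hpr ?_ ?_ fun y hy => ?_)
  · exact (intervalIntegrable_mul_levyDensity hp hpr (by fun_prop)).abs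
  · have := intervalIntegrable_mul_levyDensity (θ := θ) hp hpr (P := fun _ => 1) (by fun_prop)
    simp only [one_mul] at this
    exact this.abs
  · rw [abs_mul]
    exact mul_le_of_le_one_left (abs_nonneg _)
      (hb _ (by linarith [hy.1]) (by linarith [hy.2]))

lemma summable_leftWeight {θ : ℝ} (hθ0 : 0 < θ) : Summable (leftWeight θ) :=
  Summable.of_norm_bounded (summable_integral_abs_levyDensity hθ0) fun m =>
    abs_integral_quadratic_le m fun s h1 h2 => by rw [abs_le]; constructor <;> nlinarith

lemma summable_midWeight {θ : ℝ} (hθ0 : 0 < θ) : Summable (midWeight θ) :=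
  Summable.of_norm_bounded (summable_integral_abs_levyDensity hθ0) fun m =>
    abs_integral_quadratic_le m fun s h1 h2 => by rw [abs_le]; constructor <;> nlinarith

lemma summable_rightWeight {θ : ℝ} (hθ0 : 0 < θ) : Summable (rightWeight θ) :=
  Summable.of_norm_bounded (summable_integral_abs_levyDensity hθ0) fun m =>
    abs_integral_quadratic_le m fun s h1 h2 => by rw [abs_le]; constructor <;> nlinarith

lemma summable_unitWeight {θ : ℝ} (hθ0 : 0 < θ) (hθ1 : θ < 1) : Summable (unitWeight θ) := by
  have h1 : Summable fun m => unitWeight θ (2 * m) := by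
    rw [← summable_nat_add_iff 1]
    simpa only [mul_add, mul_one, unitWeight_even hθ0 hθ1] using summable_midWeight hθ0
  have h2 : Summable fun m => unitWeight θ (2 * m + 1) := by
    rw [← summable_nat_add_iff 1]
    have : ∀ m, 2 * (m + 1) + 1 = 2 * m + 3 := fun m => by ring
    simp only [this, unitWeight_odd hθ0 hθ1]
    exact (summable_rightWeight hθ0).add ((summable_nat_add_iff 1).2 (summable_leftWeight hθ0))
  exact (h1.hasSum.even_add_odd h2.hasSum).summable

lemma summable_mul_bounded {ι : Type*} {w f : ι → ℝ} {B : ℝ} (hw : Summable w)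
    (hf : ∀ i, |f i| ≤ B) : Summable fun i => w i * f i := by
  refine Summable.of_norm_bounded (hw.abs.mul_right B) fun i => ?_
  rw [Real.norm_eq_abs, abs_mul]
  exact mul_le_mul_of_nonneg_left (hf i) (abs_nonneg _)

/-- The quadrature rule integrates the interpolant exactly. -/
lemma tsum_unitWeight_mul {θ : ℝ} (hθ0 : 0 < θ) (hθ1 : θ < 1) {g : ℕ → ℝ} {B : ℝ}
    (hg : ∀ n, |g n| ≤ B) :
    ∑' j, unitWeight θ j * g j = ∫ y in Ioi (0 : ℝ), interp g y * levyDensity θ y := by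
  have hs := summable_mul_bounded (summable_unitWeight hθ0 hθ1) hg
  have ht2 : Tendsto (fun N : ℕ => 2 * (N : ℝ) + 1) atTop atTop :=
    tendsto_atTop_add_const_right _ _ (tendsto_natCast_atTop_atTop.const_mul_atTop two_pos)
  have h1 := intervalIntegral_tendsto_integral_Ioi (0 : ℝ)
    (integrableOn_interp_mul_levyDensity hθ0 hθ1 hg) ht2
  have h2 : Tendsto (fun N : ℕ => ∑ j ∈ Finset.range (2 * N + 2), unitWeight θ j * g j) atTop
      (𝓝 (∑' j, unitWeight θ j * g j)) :=
    hs.hasSum.tendsto_sum_nat.comp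
      (tendsto_atTop_mono (fun N => by omega : ∀ N : ℕ, N ≤ 2 * N + 2) tendsto_id)
  have h3 : Tendsto (fun N : ℕ => leftWeight θ N * g (2 * N + 1)) atTop (𝓝 0) :=
    (summable_mul_bounded (summable_leftWeight hθ0)
      fun N => hg (2 * N + 1)).tendsto_atTop_zero
  have h4 := h2.sub h3
  simp only [← integral_interp_mul_levyDensity_eq_sum hθ0 hθ1 hg, sub_zero] at h4
  exact tendsto_nhds_unique h4 h1

/-! ### Rescaling to mesh size `h` -/

lemma summable_weight {θ : ℝ} (hθ0 : 0 < θ) (hθ1 : θ < 1) (h : ℝ) : Summable (weight θ h) := by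
  refine Summable.of_nat_of_neg ?_ ?_ <;>
  · simp only [weight, Int.natAbs_neg, Int.natAbs_natCast]
    exact (summable_unitWeight hθ0 hθ1).mul_left _

lemma weight_neg (θ h : ℝ) (j : ℤ) : weight θ h (-j) = weight θ h j := by
  simp [weight]

/-- The density is homogeneous of degree `-(1 + 2θ)`, so the prefactor of the weights is exactly
absorbed by the dilation `y ↦ y / h`. -/
lemma rpow_mul_integral_comp_levyDensity {θ h : ℝ} (hh : 0 < h) (F : ℝ → ℝ) :
    h ^ (-(2 * θ)) * ∫ y in Ioi (0 : ℝ), F y * levyDensity θ y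
      = ∫ y in Ioi (0 : ℝ), F (y / h) * levyDensity θ y := by
  have h1 := integral_comp_mul_left_Ioi (fun y => F y * levyDensity θ y) 0 (inv_pos.2 hh)
  simp only [mul_zero, inv_inv, smul_eq_mul] at h1
  have h2 : ∫ y in Ioi (0 : ℝ), F y * levyDensity θ y
      = h⁻¹ * ∫ x in Ioi (0 : ℝ), F (h⁻¹ * x) * levyDensity θ (h⁻¹ * x) := by
    rw [h1, ← mul_assoc, inv_mul_cancel₀ hh.ne', one_mul]
  rw [h2, ← mul_assoc, ← integral_const_mul]
  refine setIntegral_congr_fun measurableSet_Ioi fun y hy => ?_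
  have hy0 : 0 < y := hy
  have e : h⁻¹ ^ (-(1 + 2 * θ)) = h * h ^ (2 * θ) := by
    rw [Real.inv_rpow hh.le, ← Real.rpow_neg hh.le, neg_neg, Real.rpow_add hh, Real.rpow_one]
  have e2 : h ^ (-(2 * θ)) * h ^ (2 * θ) = 1 := by
    rw [← Real.rpow_add hh, neg_add_cancel, Real.rpow_zero]
  simp only [levyDensity]
  rw [Real.mul_rpow (inv_pos.2 hh).le hy0.le, e, ← div_eq_inv_mul]
  calc _ = (h ^ (-(2 * θ)) * h ^ (2 * θ)) * (h⁻¹ * h) * (F (y / h) *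
        (fracConst θ * y ^ (-(1 + 2 * θ)))) := by ring
    _ = _ := by rw [e2, inv_mul_cancel₀ hh.ne', one_mul, one_mul]

/-- The discrete fractional Laplacian as the integral of an interpolated second difference. -/
lemma discFracLap_eq_integral {θ h : ℝ} (hθ0 : 0 < θ) (hθ1 : θ < 1) (hh : 0 < h) {f : ℤ → ℝ} {B : ℝ}
    (hf : ∀ i, |f i| ≤ B) (i : ℤ) :
    discFracLap θ h f i = ∫ y in Ioi (0 : ℝ),
      interp (fun n : ℕ => 2 * f i - f (i - n) - f (i + n)) (y / h) * levyDensity θ y := by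
  have hb : ∀ j, |f i - f (i - j)| ≤ 2 * B := fun j =>
    (abs_sub _ _).trans (by linarith [hf i, hf (i - j)])
  have hs := summable_mul_bounded (summable_weight hθ0 hθ1 h) hb
  -- Folding the sum over `ℤ` onto `ℕ` counts `j = 0` twice, which is harmless because its
  -- difference is `f i - f i = 0`.
  have h1 := hs.hasSum.nat_add_neg.tsum_eq
  simp only [weight_neg, sub_zero, sub_self, mul_zero, add_zero] at h1
  rw [discFracLap, ← h1, ← rpow_mul_integral_comp_levyDensity hh, ← tsum_unitWeight_mul hθ0 hθ1
    (B := 4 * B), ← tsum_mul_left]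
  · refine tsum_congr fun n => ?_
    simp only [weight, Int.natAbs_natCast, sub_neg_eq_add]
    ring
  · intro n
    have e : 2 * f i - f (i - n) - f (i + n) = (f i - f (i - n)) + (f i - f (i - -n)) := by
      rw [sub_neg_eq_add]
      ring
    rw [e]
    refine (abs_add_le _ _).trans ?_
    linarith [hb n, hb (-n)]

/-! ### The fractional Laplacian as an integral of second differences -/

lemma setIntegral_compl_ball (F : ℝ → ℝ) {x ε : ℝ} (hε : 0 < ε)
    (h1 : IntegrableOn (fun z => F (x + z)) (Ioi ε))
    (h2 : IntegrableOn (fun z => F (x - z)) (Ioi ε)) :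
    ∫ y in (Metric.ball x ε)ᶜ, F y = ∫ z in Ioi ε, (F (x - z) + F (x + z)) := by
  have hset : (Metric.ball x ε)ᶜ = Iic (x - ε) ∪ Ici (x + ε) := by
    ext y
    simp only [Real.ball_eq_Ioo, mem_compl_iff, mem_Ioo, mem_union, mem_Iic, mem_Ici, not_and_or,
      not_lt]
  have p1 : MeasurePreserving (fun z => x + z) volume volume := measurePreserving_add_left volume x
  have p2 : MeasurePreserving (fun z => x - z) volume volume :=
    Measure.measurePreserving_sub_left volume x
  have e1 : MeasurableEmbedding (fun z => x + z) := (Homeomorph.addLeft x).measurableEmbedding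
  have e2 : MeasurableEmbedding (fun z => x - z) := (Homeomorph.subLeft x).measurableEmbedding
  have s1 : (fun z => x + z) ⁻¹' Ici (x + ε) = Ici ε := by
    ext z
    simp
  have s2 : (fun z => x - z) ⁻¹' Iic (x - ε) = Ici ε := by
    ext z
    simp
  have i1 : IntegrableOn F (Ici (x + ε)) := by
    rw [← p1.integrableOn_comp_preimage e1, s1, integrableOn_Ici_iff_integrableOn_Ioi]
    exact h1
  have i2 : IntegrableOn F (Iic (x - ε)) := by
    rw [← p2.integrableOn_comp_preimage e2, s2, integrableOn_Ici_iff_integrableOn_Ioi]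
    exact h2
  have hdisj : Disjoint (Iic (x - ε)) (Ici (x + ε)) := by
    rw [Set.disjoint_left]
    intro y hy hy'
    simp only [mem_Iic, mem_Ici] at hy hy'
    linarith
  rw [hset, setIntegral_union hdisj measurableSet_Ici i2 i1,
    ← p1.setIntegral_preimage_emb e1 F (Ici (x + ε)),
    ← p2.setIntegral_preimage_emb e2 F (Iic (x - ε)), s1, s2, integral_Ici_eq_integral_Ioi,
    integral_Ici_eq_integral_Ioi, ← integral_add h2 h1]

/-- Folding the complement of the ball onto `(ε, ∞)` turns first differences into a second
difference. Its quadratic decay makes the integral absolutely convergent, so the principal value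
exists and `limUnder` is a genuine limit. -/
lemma fracLap_eq_integral {θ : ℝ} (hθ0 : 0 < θ) (hθ1 : θ < 1) {f : ℝ → ℝ} (hf : Continuous f)
    {A B : ℝ} (hA : ∀ x, |f x| ≤ A) {x : ℝ}
    (hB : ∀ y, 0 < y → |2 * f x - f (x - y) - f (x + y)| ≤ B * min 1 (y ^ 2)) :
    fracLap θ f x = ∫ y in Ioi (0 : ℝ), (2 * f x - f (x - y) - f (x + y)) * levyDensity θ y := by
  have hint := integrableOn_mul_rpow hθ0 hθ1 (by fun_prop) hB
  have hlim : Tendsto (fun ε : ℝ => ∫ y in (Metric.ball x ε)ᶜ, (f x - f y) / |x - y| ^ (1 + 2 * θ))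
      (𝓝[>] 0) (𝓝 (∫ y in Ioi (0 : ℝ),
        (2 * f x - f (x - y) - f (x + y)) * y ^ (-(1 + 2 * θ)))) := by
    have hc : AECover (volume.restrict (Ioi (0 : ℝ))) (𝓝[>] (0 : ℝ)) fun ε => Ioi ε :=
      aecover_Ioi_of_Ioi (tendsto_id.mono_left nhdsWithin_le_nhds)
    refine (hc.integral_tendsto_of_countably_generated hint).congr' ?_
    filter_upwards [self_mem_nhdsWithin] with ε hε
    have hε : 0 < ε := hε
    rw [Measure.restrict_restrict measurableSet_Ioi,
      inter_eq_left.2 (Ioi_subset_Ioi hε.le)]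
    have key : ∀ g : ℝ → ℝ, Continuous g →(∀ z, |g z| ≤ 2 * A) →
        IntegrableOn (fun z => g z * z ^ (-(1 + 2 * θ))) (Ioi ε) := by
      intro g hg hgA
      have h1 : IntegrableOn (fun z : ℝ => z ^ (-(1 + 2 * θ))) (Ioi ε) :=
        integrableOn_Ioi_rpow_of_lt (by linarith) hε
      exact Integrable.bdd_mul (c := 2 * A) h1 hg.aestronglyMeasurable
        (ae_of_all _ fun z => hgA z)
    have hbd : ∀ z, |f x - f z| ≤ 2 * A := fun z =>
      (abs_sub _ _).trans (by linarith [hA x, hA z])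
    have a1 : ∀ z ∈ Ioi ε, (f x - f (x + z)) / |x - (x + z)| ^ (1 + 2 * θ)
        = (f x - f (x + z)) * z ^ (-(1 + 2 * θ)) := fun z hz => by
      have hz0 : 0 < z := hε.trans hz
      rw [Real.rpow_neg hz0.le, div_eq_mul_inv, sub_add_cancel_left, abs_neg, abs_of_pos hz0]
    have a2 : ∀ z ∈ Ioi ε, (f x - f (x - z)) / |x - (x - z)| ^ (1 + 2 * θ)
        = (f x - f (x - z)) * z ^ (-(1 + 2 * θ)) := fun z hz => by
      have hz0 : 0 < z := hε.trans hz
      rw [Real.rpow_neg hz0.le, div_eq_mul_inv, sub_sub_cancel, abs_of_pos hz0]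
    rw [setIntegral_compl_ball _ hε]
    · refine setIntegral_congr_fun measurableSet_Ioi fun z hz => ?_
      simp only [a1 z hz, a2 z hz]
      ring
    · exact (key (fun z => f x - f (x + z)) (by fun_prop) fun z => hbd _).congr_fun
        (fun z hz => (a1 z hz).symm) measurableSet_Ioi
    · exact (key (fun z => f x - f (x - z)) (by fun_prop) fun z => hbd _).congr_fun
        (fun z hz => (a2 z hz).symm) measurableSet_Ioi
  rw [fracLap, hlim.limUnder_eq, ← integral_const_mul]
  refine setIntegral_congr_fun measurableSet_Ioi fun y _ => ?_
  simp only [levyDensity]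
  ring

/-- Families of bounded continuous functions with uniformly bounded second differences. -/
structure IsRegularFamily (A B : ℝ) (φ : ℝ → ℝ → ℝ) : Prop where
  cont : Continuous (Function.uncurry φ)
  bound : ∀ t x, |φ t x| ≤ A
  secondDiff : ∀ t x y, 0 < y → |2 * φ t x - φ t (x - y) - φ t (x + y)| ≤ B * min 1 (y ^ 2)

lemma IsRegularFamily.nonneg {A B : ℝ} {φ : ℝ → ℝ → ℝ} (hφ : IsRegularFamily A B φ) : 0 ≤ B := by
  have := (abs_nonneg _).trans (hφ.secondDiff 0 0 1 one_pos)
  simpa using this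

lemma IsRegularFamily.fracLap_eq {θ : ℝ} (hθ0 : 0 < θ) (hθ1 : θ < 1) {A B : ℝ} {φ : ℝ → ℝ → ℝ}
    (hφ : IsRegularFamily A B φ) (t x : ℝ) :
    fracLap θ (φ t) x
      = ∫ y in Ioi (0 : ℝ), (2 * φ t x - φ t (x - y) - φ t (x + y)) * levyDensity θ y :=
  fracLap_eq_integral hθ0 hθ1 (hφ.cont.comp (by fun_prop : Continuous fun x => (t, x)))
    (hφ.bound t) (hφ.secondDiff t x)

lemma integrableOn_mul_min_mul_abs_levyDensity {θ : ℝ} (hθ0 : 0 < θ) (hθ1 : θ < 1) (B : ℝ) :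
    IntegrableOn (fun y => B * min 1 (y ^ 2) * |levyDensity θ y|) (Ioi 0) := by
  have h := (integrableOn_mul_levyDensity hθ0 hθ1 (F := fun y => min 1 (y ^ 2)) (B := 1)
    (by fun_prop) fun y _ => by rw [one_mul, abs_of_nonneg (by positivity)]).abs.const_mul B
  refine h.congr (ae_of_all _ fun y => ?_)
  simp only [abs_mul, abs_of_nonneg (by positivity : 0 ≤ min 1 (y ^ 2)), mul_assoc]

lemma IsRegularFamily.continuous_fracLap {θ : ℝ} (hθ0 : 0 < θ) (hθ1 : θ < 1) {A B : ℝ}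
    {φ : ℝ → ℝ → ℝ} (hφ : IsRegularFamily A B φ) :
    Continuous fun p : ℝ × ℝ => fracLap θ (φ p.1) p.2 := by
  simp only [hφ.fracLap_eq hθ0 hθ1]
  have hc := hφ.cont
  have e : ∀ t x, φ t x = Function.uncurry φ (t, x) := fun _ _ => rfl
  refine continuous_of_dominated (bound := fun y => B * min 1 (y ^ 2) * |levyDensity θ y|)
    (fun p => ?_) (fun p => ?_) (integrableOn_mul_min_mul_abs_levyDensity hθ0 hθ1 B)
    (ae_of_all _ fun y => ?_)
  · refine Measurable.aestronglyMeasurable (Measurable.mul ?_ (measurable_levyDensity θ))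
    simp only [e]
    fun_prop
  · refine (ae_restrict_mem measurableSet_Ioi).mono fun y hy => ?_
    rw [Real.norm_eq_abs, abs_mul]
    exact mul_le_mul_of_nonneg_right (hφ.secondDiff _ _ y hy) (abs_nonneg _)
  · simp only [e]
    fun_prop

lemma IsRegularFamily.abs_fracLap_le {θ : ℝ} (hθ0 : 0 < θ) (hθ1 : θ < 1) {A B : ℝ}
    {φ : ℝ → ℝ → ℝ} (hφ : IsRegularFamily A B φ) (t x : ℝ) :
    |fracLap θ (φ t) x| ≤ ∫ y in Ioi (0 : ℝ), B * min 1 (y ^ 2) * |levyDensity θ y| := by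
  rw [hφ.fracLap_eq hθ0 hθ1]
  rw [← Real.norm_eq_abs]
  refine norm_integral_le_of_norm_le (integrableOn_mul_min_mul_abs_levyDensity hθ0 hθ1 B) ?_
  refine (ae_restrict_mem measurableSet_Ioi).mono fun y hy => ?_
  rw [Real.norm_eq_abs, abs_mul]
  exact mul_le_mul_of_nonneg_right (hφ.secondDiff _ _ y hy) (abs_nonneg _)

/-! ### Consistency of the discrete fractional Laplacian -/

/-- A majorant uniform in `h`. Beyond the first panel the nodes satisfy `n h ≤ 3 y`, since `2 m + 3
≤ 3 (2 m + 1)`; this costs a factor 9 per node, and three nodes give 27. -/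
lemma IsRegularFamily.abs_interp_le {A B : ℝ} {φ : ℝ → ℝ → ℝ} (hφ : IsRegularFamily A B φ)
    {h : ℝ} (hh : 0 < h) (t x y : ℝ) (hy : 0 < y) :
    |interp (fun n : ℕ => 2 * φ t x - φ t (x - n * h) - φ t (x + n * h)) (y / h)|
      ≤ 27 * B * min 1 (y ^ 2) := by
  have hB := hφ.nonneg
  have hm : 0 ≤ min 1 (y ^ 2) := by positivity
  have hyh : 0 < y / h := div_pos hy hh
  rcases le_or_gt (y / h) 1 with h1 | h1
  · rw [interp_of_le_one _ h1, abs_mul, abs_of_nonneg (sq_nonneg (y / h))]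
    have h2 := hφ.secondDiff t x (1 * h) (by positivity)
    have h3 : (y / h) ^ 2 ≤ 1 := pow_le_one₀ hyh.le h1
    have h4 : min 1 ((1 * h) ^ 2) * (y / h) ^ 2 ≤ min 1 (y ^ 2) := by
      refine le_min ?_ ?_
      · exact mul_le_one₀ (min_le_left _ _) (sq_nonneg _) h3
      · calc _ ≤ (1 * h) ^ 2 * (y / h) ^ 2 := by gcongr; exact min_le_right _ _
          _ = y ^ 2 := by field_simp
    calc _ ≤ B * min 1 ((1 * h) ^ 2) * (y / h) ^ 2 := by
            refine mul_le_mul_of_nonneg_right ?_ (sq_nonneg _)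
            exact_mod_cast h2
      _ ≤ B * min 1 (y ^ 2) := by
            rw [mul_assoc]
            gcongr
      _ ≤ _ := by nlinarith [mul_nonneg hB hm]
  · obtain ⟨m, hmem⟩ := exists_mem_Ioc_of_one_lt h1
    have hk := abs_interp_sub_le
      (fun n : ℕ => 2 * φ t x - φ t (x - n * h) - φ t (x + n * h)) 0 hmem
    simp only [sub_zero] at hk
    have key : ∀ n : ℕ, 0 < n → n ≤ 2 * m + 3 →
        |2 * φ t x - φ t (x - n * h) - φ t (x + n * h)| ≤ 9 * (B * min 1 (y ^ 2)) := by
      intro n hn hnm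
      have hn' : (0 : ℝ) < n := by exact_mod_cast hn
      have hnm' : (n : ℝ) ≤ 2 * m + 3 := by exact_mod_cast hnm
      have h5 : n * h ≤ 3 * y := by
        have h6 := mul_le_mul_of_nonneg_right hmem.1.le hh.le
        rw [div_mul_cancel₀ _ hh.ne'] at h6
        nlinarith [mul_nonneg m.cast_nonneg hh.le]
      refine (hφ.secondDiff t x (n * h) (by positivity)).trans ?_
      have h7 : min 1 ((n * h) ^ 2) ≤ 9 * min 1 (y ^ 2) := by
        rw [mul_min_of_nonneg _ _ (by norm_num : (0 : ℝ) ≤ 9)]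
        refine min_le_min (by norm_num) ?_
        nlinarith [mul_pos hn' hh]
      nlinarith
    have k1 := key (2 * m + 1) (by omega) (by omega)
    have k2 := key (2 * m + 2) (by omega) (by omega)
    have k3 := key (2 * m + 3) (by omega) le_rfl
    linarith

lemma IsRegularFamily.discFracLap_eq {θ : ℝ} (hθ0 : 0 < θ) (hθ1 : θ < 1) {A B : ℝ} {φ : ℝ → ℝ → ℝ}
    (hφ : IsRegularFamily A B φ) {h : ℝ} (hh : 0 < h) (t : ℝ) (k : ℤ) :
    discFracLap θ h (fun j => φ t (j * h)) k = ∫ y in Ioi (0 : ℝ),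
      interp (fun n : ℕ => 2 * φ t (k * h) - φ t (k * h - n * h) - φ t (k * h + n * h)) (y / h)
        * levyDensity θ y := by
  rw [discFracLap_eq_integral hθ0 hθ1 hh fun i => hφ.bound t _]
  push_cast
  simp only [sub_mul, add_mul]

lemma IsRegularFamily.abs_discFracLap_le {θ : ℝ} (hθ0 : 0 < θ) (hθ1 : θ < 1) {A B : ℝ}
    {φ : ℝ → ℝ → ℝ} (hφ : IsRegularFamily A B φ) {h : ℝ} (hh : 0 < h) (t : ℝ) (k : ℤ) :
    |discFracLap θ h (fun j => φ t (j * h)) k|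
      ≤ ∫ y in Ioi (0 : ℝ), 27 * B * min 1 (y ^ 2) * |levyDensity θ y| := by
  rw [hφ.discFracLap_eq hθ0 hθ1 hh]
  rw [← Real.norm_eq_abs]
  refine norm_integral_le_of_norm_le (integrableOn_mul_min_mul_abs_levyDensity hθ0 hθ1 (27 * B)) ?_
  refine (ae_restrict_mem measurableSet_Ioi).mono fun y hy => ?_
  rw [Real.norm_eq_abs, abs_mul]
  exact mul_le_mul_of_nonneg_right (hφ.abs_interp_le hh _ _ y hy) (abs_nonneg _)

/-- Once `h < y`, the three nodes around `y / h`, scaled by `h`, lie within `2 h` of `y`. All three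
nodal values then converge to the second difference at `y`, and `abs_interp_sub_le` controls the
interpolant by them. -/
lemma IsRegularFamily.tendsto_interp {ι : Type*} {l : Filter ι} [l.NeBot] {A B : ℝ} {φ : ℝ → ℝ → ℝ}
    (hφ : IsRegularFamily A B φ) {h τ ξ : ι → ℝ} {t x y : ℝ} (hy : 0 < y)
    (hpos : ∀ᶠ d in l, 0 < h d) (hh : Tendsto h l (𝓝 0)) (hτ : Tendsto τ l (𝓝 t))
    (hξ : Tendsto ξ l (𝓝 x)) :
    Tendsto (fun d => interp (fun n : ℕ =>
        2 * φ (τ d) (ξ d) - φ (τ d) (ξ d - n * h d) - φ (τ d) (ξ d + n * h d)) (y / h d)) l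
      (𝓝 (2 * φ t x - φ t (x - y) - φ t (x + y))) := by
  have hex : ∀ᶠ d in l, ∃ m : ℕ, y / h d ∈ Ioc (2 * (m : ℝ) + 1) (2 * m + 3) := by
    filter_upwards [hpos, hh.eventually_lt_const hy] with d h1 h2
    exact exists_mem_Ioc_of_one_lt ((one_lt_div h1).2 h2)
  obtain ⟨m, hm⟩ := hex.choice
  have hz : ∀ c : ℕ, 1 ≤ c → c ≤ 3 → Tendsto (fun d => ((2 * m d + c : ℕ) : ℝ) * h d) l (𝓝 y) := by
    intro c h1 h3
    have h1' : (1 : ℝ) ≤ c := by exact_mod_cast h1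
    have h3' : (c : ℝ) ≤ 3 := by exact_mod_cast h3
    have t1 : Tendsto (fun d => y - 2 * h d) l (𝓝 y) := by
      simpa using (hh.const_mul 2).const_sub y
    have t2 : Tendsto (fun d => y + 2 * h d) l (𝓝 y) := by
      simpa using (hh.const_mul 2).const_add y
    refine tendsto_of_tendsto_of_tendsto_of_le_of_le' t1 t2 ?_ ?_
    all_goals
      filter_upwards [hpos, hm] with d p1 p2
      have q1 := mul_lt_mul_of_pos_right p2.1 p1
      have q2 := mul_le_mul_of_nonneg_right p2.2 p1.le
      rw [div_mul_cancel₀ _ p1.ne'] at q1 q2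
      push_cast
      nlinarith
  have hg : ∀ c : ℕ, 1 ≤ c → c ≤ 3 → Tendsto (fun d =>
      |(2 * φ (τ d) (ξ d) - φ (τ d) (ξ d - ((2 * m d + c : ℕ) : ℝ) * h d)
        - φ (τ d) (ξ d + ((2 * m d + c : ℕ) : ℝ) * h d))
        - (2 * φ t x - φ t (x - y) - φ t (x + y))|) l (𝓝 0) := by
    intro c h1 h3
    have hc : ∀ {ζ : ι → ℝ} {z : ℝ}, Tendsto ζ l (𝓝 z) →
        Tendsto (fun d => φ (τ d) (ζ d)) l (𝓝 (φ t z)) := fun hζ =>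
      (hφ.cont.tendsto (t, _)).comp (hτ.prodMk_nhds hζ)
    have := (((hc hξ).const_mul 2).sub (hc (hξ.sub (hz c h1 h3)))).sub (hc (hξ.add (hz c h1 h3)))
    simpa using (this.sub_const (2 * φ t x - φ t (x - y) - φ t (x + y))).abs
  rw [tendsto_iff_norm_sub_tendsto_zero]
  have hsum := ((hg 1 le_rfl (by omega)).add (hg 2 (by omega) (by omega))).add
    (hg 3 (by omega) le_rfl)
  simp only [add_zero] at hsum
  refine squeeze_zero' (Eventually.of_forall fun d => norm_nonneg _) ?_ hsum
  filter_upwards [hm] with d p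
  exact abs_interp_sub_le _ _ p

/-- Consistency: the discrete fractional Laplacian at moving grid points and times converges to
the fractional Laplacian. -/
lemma IsRegularFamily.tendsto_discFracLap {ι : Type*} {l : Filter ι} [l.NeBot]
    [l.IsCountablyGenerated] {θ : ℝ} (hθ0 : 0 < θ) (hθ1 : θ < 1) {A B : ℝ} {φ : ℝ → ℝ → ℝ}
    (hφ : IsRegularFamily A B φ) {h τ : ι → ℝ} {k : ι → ℤ} {t x : ℝ}
    (hpos : ∀ᶠ d in l, 0 < h d) (hh : Tendsto h l (𝓝 0)) (hτ : Tendsto τ l (𝓝 t))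
    (hk : Tendsto (fun d => k d * h d) l (𝓝 x)) :
    Tendsto (fun d => discFracLap θ (h d) (fun j => φ (τ d) (j * h d)) (k d)) l
      (𝓝 (fracLap θ (φ t) x)) := by
  rw [hφ.fracLap_eq hθ0 hθ1]
  have heq : (fun d => ∫ y in Ioi (0 : ℝ), interp (fun n : ℕ => 2 * φ (τ d) (k d * h d)
        - φ (τ d) (k d * h d - n * h d) - φ (τ d) (k d * h d + n * h d)) (y / h d)
        * levyDensity θ y)
      =ᶠ[l] fun d => discFracLap θ (h d) (fun j => φ (τ d) (j * h d)) (k d) := by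
    filter_upwards [hpos] with d hd
    exact (hφ.discFracLap_eq hθ0 hθ1 hd _ _).symm
  refine Tendsto.congr' heq ?_
  refine tendsto_integral_filter_of_dominated_convergence
    (fun y => 27 * B * min 1 (y ^ 2) * |levyDensity θ y|) (Eventually.of_forall fun d => ?_) ?_
    (integrableOn_mul_min_mul_abs_levyDensity hθ0 hθ1 (27 * B)) ?_
  · exact (((measurable_interp _).comp (by fun_prop)).mul
      (measurable_levyDensity θ)).aestronglyMeasurable
  · filter_upwards [hpos] with d hd
    refine (ae_restrict_mem measurableSet_Ioi).mono fun y hy => ?_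
    rw [Real.norm_eq_abs, abs_mul]
    exact mul_le_mul_of_nonneg_right (hφ.abs_interp_le hd _ _ y hy) (abs_nonneg _)
  · refine (ae_restrict_mem measurableSet_Ioi).mono fun y hy => ?_
    exact (hφ.tendsto_interp hy hpos hh hτ hk).mul_const _

/-! ### Test functions -/

lemma IsTestFunction.eq_zero {L T : ℝ} {φ : ℝ → ℝ → ℝ} (hφ : IsTestFunction L T φ) {t x : ℝ}
    (h : (t, x) ∉ Iio T ×ˢ Ioo (-L) L) : φ t x = 0 :=
  image_eq_zero_of_notMem_tsupport (f := Function.uncurry φ) fun h' => h (hφ.supp h')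

lemma IsTestFunction.deriv_eq_zero {L T : ℝ} {φ : ℝ → ℝ → ℝ} (hφ : IsTestFunction L T φ) {t x : ℝ}
    (h : T ≤ t) : deriv (fun s => φ s x) t = 0 := by
  have h1 : (t, x) ∉ tsupport (Function.uncurry φ) := fun h' =>
    absurd (hφ.supp h').1 (not_lt.2 h)
  have h2 := (notMem_tsupport_iff_eventuallyEq.1 h1)
  have h3 : (fun s => φ s x) =ᶠ[𝓝 t] fun _ => 0 :=
    (by fun_prop : Continuous fun s : ℝ => (s, x)).continuousAt.eventually h2
  rw [h3.deriv_eq, deriv_const]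

lemma fracLap_zero (θ x : ℝ) : fracLap θ (fun _ => 0) x = 0 := by
  have h : Tendsto (fun _ : ℝ => (0 : ℝ)) (𝓝[>] 0) (𝓝 0) := tendsto_const_nhds
  simp [fracLap, h.limUnder_eq]

lemma IsTestFunction.fracLap_eq_zero {L T : ℝ} {φ : ℝ → ℝ → ℝ} (hφ : IsTestFunction L T φ)
    {t : ℝ} (h : T ≤ t) (θ x : ℝ) : fracLap θ (φ t) x = 0 := by
  have : φ t = fun _ => 0 := funext fun y => hφ.eq_zero fun h' => absurd h'.1 (not_lt.2 h)
  rw [this, fracLap_zero]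

lemma IsTestFunction.hasFDerivAt {L T : ℝ} {φ : ℝ → ℝ → ℝ} (hφ : IsTestFunction L T φ) (p : ℝ × ℝ) :
    HasFDerivAt (Function.uncurry φ) (fderiv ℝ (Function.uncurry φ) p) p :=
  (hφ.smooth.differentiable (by simp)).differentiableAt.hasFDerivAt

lemma IsTestFunction.exists_isRegularFamily {L T : ℝ} {φ : ℝ → ℝ → ℝ} (hφ : IsTestFunction L T φ) :
    ∃ A B, IsRegularFamily A B φ := by
  obtain ⟨A, hA⟩ := hφ.compact.exists_bound_of_continuous hφ.smooth.continuous
  obtain ⟨C, hC⟩ := ContDiff.lipschitzWith_of_hasCompactSupport (𝕂 := ℝ) (n := ∞)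
    (hφ.compact.fderiv ℝ) (hφ.smooth.fderiv_right (m := ∞) le_rfl) (by simp)
  -- `4 A` bounds the second difference trivially. With `C` a Lipschitz constant of the derivative,
  -- its `s`-derivative `D (x - s) - D (x + s)` is at most `2 C s`, so the mean value inequality
  -- gives `2 C y²`.
  refine ⟨A, 4 * A + 2 * C, hφ.smooth.continuous, fun t x => hA (t, x), fun t x y hy => ?_⟩
  have hA0 : 0 ≤ A := (norm_nonneg _).trans (hA 0)
  have hbd : ∀ z, |φ t z| ≤ A := fun z => hA (t, z)
  have b1 : |2 * φ t x - φ t (x - y) - φ t (x + y)| ≤ 4 * A := by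
    have h1 := abs_le.1 (hbd x)
    have h2 := abs_le.1 (hbd (x - y))
    have h3 := abs_le.1 (hbd (x + y))
    rw [abs_le]
    constructor <;> linarith
  have b2 : |2 * φ t x - φ t (x - y) - φ t (x + y)| ≤ 2 * C * y ^ 2 := by
    set D : ℝ → ℝ := fun z => fderiv ℝ (Function.uncurry φ) (t, z) (0, 1) with hD
    have hd : ∀ z, HasDerivAt (φ t) (D z) z := fun z =>
      (hφ.hasFDerivAt (t, z)).comp_hasDerivAt z ((hasDerivAt_const z t).prodMk (hasDerivAt_id z))
    have hDl : ∀ z w, |D z - D w| ≤ C * |z - w| := fun z w => by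
      have h1 := hC.norm_sub_le (t, z) (t, w)
      have h2 : D z - D w = (fderiv ℝ (Function.uncurry φ) (t, z)
          - fderiv ℝ (Function.uncurry φ) (t, w)) (0, 1) := rfl
      rw [h2, ← Real.norm_eq_abs]
      refine (ContinuousLinearMap.le_opNorm _ _).trans ?_
      simpa [Prod.norm_def] using h1
    have hk : ∀ s ∈ Icc 0 y, HasDerivWithinAt (fun s => 2 * φ t x - φ t (x - s) - φ t (x + s))
        (D (x - s) - D (x + s)) (Icc 0 y) s := fun s _ => by
      have e1 : HasDerivAt (fun s => φ t (x - s)) (D (x - s) * -1) s :=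
        (hd (x - s)).comp s ((hasDerivAt_id s).const_sub x)
      have e2 : HasDerivAt (fun s => φ t (x + s)) (D (x + s) * 1) s :=
        (hd (x + s)).comp s ((hasDerivAt_id s).const_add x)
      exact ((e1.const_sub (2 * φ t x)).sub e2).congr_deriv (by ring) |>.hasDerivWithinAt
    have := Convex.norm_image_sub_le_of_norm_hasDerivWithin_le (C := 2 * C * y) hk (fun s hs => ?_)
      (convex_Icc 0 y) (left_mem_Icc.2 hy.le) (right_mem_Icc.2 hy.le)
    · simp only [sub_zero, add_zero, Real.norm_eq_abs, abs_of_pos hy] at this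
      rw [show 2 * φ t x - φ t (x - y) - φ t (x + y)
        = 2 * φ t x - φ t (x - y) - φ t (x + y) - (2 * φ t x - φ t x - φ t x) by ring]
      linarith
    · refine (hDl _ _).trans ?_
      rw [show x - s - (x + s) = -(2 * s) by ring, abs_neg, abs_of_nonneg (by linarith [hs.1])]
      have := mul_le_mul_of_nonneg_left hs.2 C.coe_nonneg
      linarith
  have hC0 := C.coe_nonneg
  rcases le_total 1 (y ^ 2) with h | h
  · rw [min_eq_left h]
    linarith
  · rw [min_eq_right h]
    nlinarith [sq_nonneg y]

lemma IsTestFunction.exists_lipschitz {L T : ℝ} {φ : ℝ → ℝ → ℝ} (hφ : IsTestFunction L T φ) :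
    ∃ C : ℝ, 0 ≤ C ∧ ∀ s t x, |φ s x - φ t x| ≤ C * |s - t| := by
  obtain ⟨C, hC⟩ := hφ.smooth.lipschitzWith_of_hasCompactSupport hφ.compact (by simp)
  refine ⟨C, C.coe_nonneg, fun s t x => ?_⟩
  simpa [Prod.norm_def] using hC.norm_sub_le (s, x) (t, x)

lemma IsTestFunction.hasDerivAt {L T : ℝ} {φ : ℝ → ℝ → ℝ} (hφ : IsTestFunction L T φ) (t x : ℝ) :
    HasDerivAt (fun s => φ s x) (fderiv ℝ (Function.uncurry φ) (t, x) (1, 0)) t :=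
  (hφ.hasFDerivAt (t, x)).comp_hasDerivAt (f := fun s => (s, x)) t
    ((hasDerivAt_id' t).prodMk (hasDerivAt_const t x))

lemma IsTestFunction.continuous_deriv {L T : ℝ} {φ : ℝ → ℝ → ℝ} (hφ : IsTestFunction L T φ) :
    Continuous fun p : ℝ × ℝ => deriv (fun s => φ s p.2) p.1 := by
  simp only [(hφ.hasDerivAt _ _).deriv]
  exact (hφ.smooth.continuous_fderiv (by simp)).clm_apply continuous_const

lemma abs_deriv_le_of_lipschitz {φ : ℝ → ℝ → ℝ} {C : ℝ}
    (hC0 : 0 ≤ C) (hC : ∀ s t x, |φ s x - φ t x| ≤ C * |s - t|) (t x : ℝ) :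
    |deriv (fun s => φ s x) t| ≤ C := by
  have h : LipschitzWith ⟨C, hC0⟩ fun s => φ s x := LipschitzWith.of_dist_le_mul fun s r => hC s r x
  exact norm_deriv_le_of_lipschitz h

/-- Both times and the space point move with the mesh, so differentiability at `(t, x)` alone is not
enough; strict differentiability is. -/
lemma IsTestFunction.tendsto_slope {ι : Type*} {l : Filter ι} {L T : ℝ} {φ : ℝ → ℝ → ℝ}
    (hφ : IsTestFunction L T φ) {δ σ τ ξ : ι → ℝ} {t x : ℝ} (hδ : ∀ d, σ d - τ d = δ d)
    (hσ : Tendsto σ l (𝓝 t)) (hτ : Tendsto τ l (𝓝 t)) (hξ : Tendsto ξ l (𝓝 x))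
    (hpos : ∀ᶠ d in l, 0 < δ d) :
    Tendsto (fun d => (φ (σ d) (ξ d) - φ (τ d) (ξ d)) / δ d) l
      (𝓝 (deriv (fun s => φ s x) t)) := by
  have h1 : HasStrictFDerivAt (Function.uncurry φ) (fderiv ℝ (Function.uncurry φ) (t, x)) (t, x) :=
    (hφ.smooth.contDiffAt).hasStrictFDerivAt (by simp)
  have h2 : Tendsto (fun d => ((σ d, ξ d), (τ d, ξ d))) l (𝓝 ((t, x), (t, x))) :=
    (hσ.prodMk_nhds hξ).prodMk_nhds (hτ.prodMk_nhds hξ)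
  have h3 := h1.isLittleO.comp_tendsto h2
  have h4 : (fun d => φ (σ d) (ξ d) - φ (τ d) (ξ d)
      - fderiv ℝ (Function.uncurry φ) (t, x) (1, 0) * δ d) =o[l] δ := by
    refine (h3.congr_left fun d => ?_).trans_isBigO ?_
    · have : ((σ d, ξ d) : ℝ × ℝ) - (τ d, ξ d) = δ d • ((1, 0) : ℝ × ℝ) := by
        ext <;> simp [hδ]
      simp only [Function.comp, this, map_smul, smul_eq_mul, Function.uncurry]
      ring
    · refine Asymptotics.IsBigO.of_bound 1 (Eventually.of_forall fun d => ?_)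
      simp [Prod.norm_def, hδ]
  have h5 := h4.tendsto_div_nhds_zero.add_const (fderiv ℝ (Function.uncurry φ) (t, x) (1, 0))
  rw [zero_add] at h5
  rw [(hφ.hasDerivAt t x).deriv]
  refine h5.congr' ?_
  filter_upwards [hpos] with d hd
  field_simp
  ring

/-! ### The odd power -/

lemma abs_oddPow {r : ℝ} (hr : 0 < r) (x : ℝ) : |oddPow r x| = |x| ^ r := by
  rcases eq_or_ne x 0 with rfl | hx
  · simp [oddPow, Real.zero_rpow hr.ne']
  · have hx' : 0 < |x| := abs_pos.2 hx
    rw [oddPow, abs_mul, abs_of_nonneg (Real.rpow_nonneg hx'.le _)]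
    rw [← Real.rpow_add_one hx'.ne', sub_add_cancel]

lemma oddPow_zero (r : ℝ) : oddPow r 0 = 0 := by simp [oddPow]

lemma abs_oddPow_le {r : ℝ} (hr : 0 < r) {x K : ℝ} (hx : |x| ≤ K) : |oddPow r x| ≤ K ^ r := by
  rw [abs_oddPow hr]
  exact Real.rpow_le_rpow (abs_nonneg _) hx hr.le

/-- For `r < 1` the factor `|x| ^ (r - 1)` blows up at the origin, so continuity there is read off
from `|oddPow r x| = |x| ^ r`. -/
lemma continuous_oddPow {r : ℝ} (hr : 0 < r) : Continuous (oddPow r) := by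
  rw [continuous_iff_continuousAt]
  intro x
  rcases eq_or_ne x 0 with rfl | hx
  · rw [ContinuousAt, oddPow_zero, tendsto_zero_iff_abs_tendsto_zero]
    simp only [Function.comp_def, abs_oddPow hr]
    have : Continuous fun x : ℝ => |x| ^ r := continuous_abs.rpow_const fun _ => Or.inr hr.le
    simpa [Real.zero_rpow hr.ne'] using this.tendsto 0
  · exact (continuous_abs.continuousAt.rpow_const (Or.inl (abs_ne_zero.2 hx))).mul continuousAt_id

/-! ### Summation by parts -/

lemma discFracLap_eq_sum {θ : ℝ} (hθ0 : 0 < θ) (hθ1 : θ < 1) (h : ℝ) {f : ℤ → ℝ} {s : Finset ℤ}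
    (hf : ∀ i ∉ s, f i = 0) (i : ℤ) :
    discFracLap θ h f i = (∑' j, weight θ h j) * f i - ∑ k ∈ s, weight θ h (i - k) * f k := by
  have hw := summable_weight hθ0 hθ1 h
  have h1 : (∑' j, weight θ h j * f (i - j)) = ∑ k ∈ s, weight θ h (i - k) * f k := by
    rw [← (Equiv.subLeft i).tsum_eq]
    simp only [Equiv.subLeft_apply, sub_sub_cancel]
    exact tsum_eq_sum fun k hk => by rw [hf k hk, mul_zero]
  have h2 : Summable fun j => weight θ h j * f (i - j) := by
    rw [← (Equiv.subLeft i).summable_iff]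
    refine summable_of_ne_finset_zero (s := s) fun k hk => ?_
    simp [hf k hk]
  rw [discFracLap, ← h1, ← tsum_mul_right, ← (hw.mul_right (f i)).tsum_sub h2]
  exact tsum_congr fun j => by ring

/-- The diagonal part is visibly symmetric, and the remaining kernel `w (i - k)` is even. Finite
supports allow the interchange of sums. -/
lemma sum_discFracLap_mul_comm {θ : ℝ} (hθ0 : 0 < θ) (hθ1 : θ < 1) (h : ℝ) {f g : ℤ → ℝ}
    {s : Finset ℤ} (hf : ∀ i ∉ s, f i = 0) (hg : ∀ i ∉ s, g i = 0) :
    ∑ i ∈ s, discFracLap θ h f i * g i = ∑ i ∈ s, f i * discFracLap θ h g i := by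
  simp only [discFracLap_eq_sum hθ0 hθ1 h hf, discFracLap_eq_sum hθ0 hθ1 h hg, sub_mul, mul_sub,
    Finset.sum_sub_distrib, Finset.sum_mul, Finset.mul_sum]
  congr 1
  · exact Finset.sum_congr rfl fun i _ => by ring
  · rw [Finset.sum_comm]
    refine Finset.sum_congr rfl fun i _ => Finset.sum_congr rfl fun k _ => ?_
    rw [← weight_neg, neg_sub]
    ring

/-- The discrete weak formulation. -/
lemma IsFDSolution.sum_eq {θ q Δt h : ℝ} {M : ℕ} {u0 : ℤ → ℝ} {u : ℕ → ℤ → ℝ} (hθ0 : 0 < θ)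
    (hθ1 : θ < 1) (hu : IsFDSolution θ q Δt h M u0 u) {ψ : ℕ → ℤ → ℝ}
    (hψ : ∀ n i, (M : ℤ) < |i| → ψ n i = 0) {N : ℕ} (hN : ∀ i, ψ N i = 0) :
    ∑ n ∈ Finset.range N, ∑ i ∈ Finset.Icc (-(M : ℤ)) M,
        (-(oddPow (q - 1) (u n i) * ((ψ (n + 1) i - ψ n i) / Δt))
          + u n i * discFracLap θ h (ψ n) i)
      = ∑ i ∈ Finset.Icc (-(M : ℤ)) M,
        (oddPow (q - 1) (u 0 i) * ψ 0 i / Δt + u 0 i * discFracLap θ h (ψ 0) i) := by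
  have hs : ∀ i, i ∉ Finset.Icc (-(M : ℤ)) M ↔ (M : ℤ) < |i| := fun i => by
    rw [Finset.mem_Icc, ← abs_le, not_le]
  set E : ℕ → ℝ := fun n => ∑ i ∈ Finset.Icc (-(M : ℤ)) M,
    (oddPow (q - 1) (u n i) * ψ n i / Δt + u n i * discFracLap θ h (ψ n) i) with hE
  have hEN : E N = 0 := by
    have : ψ N = fun _ => 0 := funext hN
    simp [hE, this, discFracLap]
  -- The scheme tested with `ψ (n + 1)`, after symmetry has moved the Laplacian. Each summand on the
  -- left of the claim is then `E n - E (n + 1)`, and the sum telescopes to `E 0`.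
  have hstep : ∀ n, E (n + 1)
      = ∑ i ∈ Finset.Icc (-(M : ℤ)) M, oddPow (q - 1) (u n i) * ψ (n + 1) i / Δt := by
    intro n
    simp only [hE, Finset.sum_add_distrib]
    rw [← sum_discFracLap_mul_comm hθ0 hθ1 h (fun i hi => hu.exterior (n + 1) i ((hs i).1 hi))
      (fun i hi => hψ (n + 1) i ((hs i).1 hi)), ← Finset.sum_add_distrib]
    refine Finset.sum_congr rfl fun i hi => ?_
    have h1 := hu.scheme n i (abs_le.2 (Finset.mem_Icc.1 hi))
    linear_combination ψ (n + 1) i * h1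
  calc _ = ∑ n ∈ Finset.range N, (E n - E (n + 1)) := by
        refine Finset.sum_congr rfl fun n _ => ?_
        rw [hstep, ← Finset.sum_sub_distrib]
        exact Finset.sum_congr rfl fun i _ => by ring
    _ = E 0 := by rw [Finset.sum_range_sub', hEN, sub_zero]

/-! ### Integrals of piecewise constant functions -/

lemma setIntegral_sum_indicator_Ico {ι : Type*} (s : Finset ι) (a : ι → ℝ) {δ : ℝ} (hδ : 0 ≤ δ)
    {S : Set ℝ} (hS : ∀ i ∈ s, Ico (a i) (a i + δ) ⊆ S) (f : ι → ℝ) :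
    ∫ x in S, ∑ i ∈ s, (Ico (a i) (a i + δ)).indicator (fun _ => f i) x = δ * ∑ i ∈ s, f i := by
  rw [integral_finsetSum, Finset.mul_sum]
  · refine Finset.sum_congr rfl fun i hi => ?_
    rw [integral_indicator measurableSet_Ico, Measure.restrict_restrict measurableSet_Ico,
      inter_eq_left.2 (hS i hi), setIntegral_const, Real.volume_real_Ico]
    simp [hδ]
  · intro i hi
    rw [integrable_indicator_iff measurableSet_Ico, IntegrableOn,
      Measure.restrict_restrict measurableSet_Ico, inter_eq_left.2 (hS i hi)]
    exact integrableOn_const (by simp)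

/-- The cells with `|i| ≤ M` lie inside `(-L, L)`; the two leftover strips of width `h / 2` belong
to the indices `±(M + 1)`, where `f` vanishes. -/
lemma setIntegral_spaceRecon {h L : ℝ} (hh : 0 < h) {M : ℕ} (hL : L = ((M : ℝ) + 1) * h)
    {f : ℤ → ℝ} (hf : ∀ i, (M : ℤ) < |i| → f i = 0) :
    ∫ x in Ioo (-L) L, spaceRecon h f x = h * ∑ i ∈ Finset.Icc (-(M : ℤ)) M, f i := by
  rw [← setIntegral_sum_indicator_Ico (Finset.Icc (-(M : ℤ)) M) (fun i => i * h - h / 2) hh.le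
    (S := Ioo (-L) L)]
  · refine setIntegral_congr_fun measurableSet_Ioo fun x _ => ?_
    have key : ∀ i : ℤ, x ∈ Ico (i * h - h / 2) (i * h - h / 2 + h) ↔ i = ⌊x / h + 1 / 2⌋ := by
      intro i
      rw [eq_comm, Int.floor_eq_iff, mem_Ico, ← sub_le_iff_le_add, le_div_iff₀ hh,
        ← lt_sub_iff_add_lt, div_lt_iff₀ hh]
      constructor <;> rintro ⟨h1, h2⟩ <;> constructor <;> linarith
    simp only [indicator, key, spaceRecon]
    rw [Finset.sum_ite_eq']
    split_ifs with hi
    · rfl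
    · exact hf _ (by rwa [Finset.mem_Icc, ← abs_le, not_le] at hi)
  · intro i hi x hx
    have h1 : (-(M : ℝ)) ≤ i := by exact_mod_cast (Finset.mem_Icc.1 hi).1
    have h2 : (i : ℝ) ≤ M := by exact_mod_cast (Finset.mem_Icc.1 hi).2
    have h3 := mul_le_mul_of_nonneg_right h1 hh.le
    have h4 := mul_le_mul_of_nonneg_right h2 hh.le
    rw [hL]
    constructor <;> linarith [hx.1, hx.2]

lemma setIntegral_floor_div {δ R : ℝ} (hδ : 0 < δ) {N : ℕ} (hN : N * δ ≤ R) {f : ℕ → ℝ}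
    (hf : ∀ n, N ≤ n → f n = 0) :
    ∫ t in Ioo 0 R, f ⌊t / δ⌋₊ = δ * ∑ n ∈ Finset.range N, f n := by
  rw [← integral_Ico_eq_integral_Ioo, ← setIntegral_sum_indicator_Ico (Finset.range N)
    (fun n => n * δ) hδ.le (S := Ico 0 R)]
  · refine setIntegral_congr_fun measurableSet_Ico fun t ht => ?_
    have h0 : 0 ≤ t / δ := div_nonneg ht.1 hδ.le
    have key : ∀ n : ℕ, t ∈ Ico (n * δ) (n * δ + δ) ↔ n = ⌊t / δ⌋₊ := by
      intro n
      rw [eq_comm, Nat.floor_eq_iff h0, mem_Ico, le_div_iff₀ hδ, div_lt_iff₀ hδ, add_mul, one_mul]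
    simp only [indicator, key]
    rw [Finset.sum_ite_eq']
    split_ifs with hi
    · rfl
    · exact hf _ (by simpa using hi)
  · intro n hn t ht
    have h1 : (n : ℝ) + 1 ≤ N := by exact_mod_cast Finset.mem_range.1 hn
    have h2 := mul_le_mul_of_nonneg_right h1 hδ.le
    have h3 : 0 ≤ n * δ := by positivity
    constructor <;> linarith [ht.1, ht.2]

/-! ### Grid points -/

lemma tendsto_floor_div_mul {ι : Type*} {l : Filter ι} {δ : ι → ℝ} (hpos : ∀ᶠ d in l, 0 < δ d)
    (hδ : Tendsto δ l (𝓝 0)) {t : ℝ} (ht : 0 ≤ t) :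
    Tendsto (fun d => (⌊t / δ d⌋₊ : ℝ) * δ d) l (𝓝 t) := by
  have h1 : Tendsto (fun d => t - δ d) l (𝓝 t) := by simpa using hδ.const_sub t
  refine tendsto_of_tendsto_of_tendsto_of_le_of_le' h1 tendsto_const_nhds ?_ ?_ <;>
    filter_upwards [hpos] with d hd
  · have := mul_lt_mul_of_pos_right (Nat.lt_floor_add_one (t / δ d)) hd
    rw [div_mul_cancel₀ _ hd.ne'] at this
    linarith
  · have := mul_le_mul_of_nonneg_right (Nat.floor_le (div_nonneg ht hd.le)) hd.le
    rwa [div_mul_cancel₀ _ hd.ne'] at this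

lemma tendsto_round_div_mul {ι : Type*} {l : Filter ι} {h : ι → ℝ} (hpos : ∀ᶠ d in l, 0 < h d)
    (hh : Tendsto h l (𝓝 0)) (x : ℝ) :
    Tendsto (fun d => (⌊x / h d + 1 / 2⌋ : ℝ) * h d) l (𝓝 x) := by
  have h1 : Tendsto (fun d => x - h d) l (𝓝 x) := by simpa using hh.const_sub x
  have h2 : Tendsto (fun d => x + h d) l (𝓝 x) := by simpa using hh.const_add x
  refine tendsto_of_tendsto_of_tendsto_of_le_of_le' h1 h2 ?_ ?_ <;>
    filter_upwards [hpos] with d hd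
  · have := mul_lt_mul_of_pos_right (Int.lt_floor_add_one (x / h d + 1 / 2)) hd
    rw [add_mul, div_mul_cancel₀ _ hd.ne'] at this
    linarith
  · have := mul_le_mul_of_nonneg_right (Int.floor_le (x / h d + 1 / 2)) hd.le
    rw [add_mul, div_mul_cancel₀ _ hd.ne'] at this
    linarith

lemma measurable_comp_round (h : ℝ) (f : ℤ → ℝ) : Measurable fun x : ℝ => f ⌊x / h + 1 / 2⌋ :=
  (measurable_of_countable f).comp (Int.measurable_floor.comp (by fun_prop))

lemma measurable_comp_floor_round (Δt h : ℝ) (F : ℕ → ℤ → ℝ) :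
    Measurable fun p : ℝ × ℝ => F ⌊p.1 / Δt⌋₊ ⌊p.2 / h + 1 / 2⌋ :=
  (measurable_of_countable (Function.uncurry F)).comp
    ((Nat.measurable_floor.comp (by fun_prop)).prodMk (Int.measurable_floor.comp (by fun_prop)))

lemma spaceRecon_eq_zero {h L x : ℝ} (hh : 0 < h) {M : ℕ} (hL : L = ((M : ℝ) + 1) * h)
    {f : ℤ → ℝ} (hf : ∀ i, (M : ℤ) + 1 ≤ |i| → f i = 0) (hx : x ∉ Ioo (-L) L) :
    spaceRecon h f x = 0 := by
  refine hf _ ?_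
  rw [le_abs]
  rcases le_or_gt L x with h1 | h1
  · left
    rw [Int.le_floor]
    push_cast
    have : (M : ℝ) + 1 ≤ x / h := by rwa [le_div_iff₀ hh, ← hL]
    linarith
  · right
    have h2 : x ≤ -L := by
      by_contra h'
      exact hx ⟨not_le.1 h', h1⟩
    have h3 : x / h ≤ -((M : ℝ) + 1) := by
      rw [div_le_iff₀ hh]
      linarith
    have h4 : (⌊x / h + 1 / 2⌋ : ℝ) < -M := (Int.floor_le _).trans_lt (by linarith)
    have h5 : ⌊x / h + 1 / 2⌋ < -(M : ℤ) := by exact_mod_cast h4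
    omega

/-- An essential bound on the reconstruction is a bound on the grid values. -/
lemma abs_le_of_eLpNorm_recon_le {Δt h R : ℝ} (hΔt : 0 < Δt) (hh : 0 < h) {u : ℕ → ℤ → ℝ} {K : ℝ≥0}
    (hK : eLpNorm (recon Δt h u) ∞ (volume.restrict (Ioo 0 R ×ˢ (univ : Set ℝ))) ≤ K)
    {n : ℕ} (hn : n * Δt < R) (i : ℤ) : |u n i| ≤ K := by
  have hae : ∀ᵐ p ∂(volume.restrict (Ioo 0 R ×ˢ (univ : Set ℝ))), ‖recon Δt h u p‖ₑ ≤ K := by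
    rw [eLpNorm_exponent_top] at hK
    filter_upwards [enorm_ae_le_eLpNormEssSup (recon Δt h u)
      (volume.restrict (Ioo 0 R ×ˢ (univ : Set ℝ)))] with p hp using hp.trans hK
  -- The part of the open cell before time `R` has positive measure, so the almost everywhere bound
  -- holds at one of its points, where the reconstruction equals `u n i`. The minimum is needed
  -- since the last cell may overhang `R`.
  set C : Set (ℝ × ℝ) := Ioo (n * Δt) (min ((n + 1) * Δt) R) ×ˢ
    Ioo (i * h - h / 2) (i * h + h / 2) with hC
  have hn0 : 0 ≤ n * Δt := by positivity
  have hsub : C ⊆ Ioo 0 R ×ˢ (univ : Set ℝ) := fun p hp =>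
    ⟨⟨hn0.trans_lt hp.1.1, hp.1.2.trans_le (min_le_right _ _)⟩, mem_univ _⟩
  have hne : volume C ≠ 0 := by
    refine (isOpen_Ioo.prod isOpen_Ioo).measure_ne_zero volume ?_
    refine (nonempty_Ioo.2 (lt_min ?_ hn)).prod (nonempty_Ioo.2 (by linarith))
    linarith
  have : (ae (volume.restrict C)).NeBot := ae_restrict_neBot.2 hne
  obtain ⟨p, hp1, hp2⟩ := ((ae_restrict_of_ae_restrict_of_subset hsub hae).and
    (ae_restrict_mem (measurableSet_Ioo.prod measurableSet_Ioo))).exists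
  have e : recon Δt h u p = u n i := recon_eq hΔt hh u n i
    ⟨hp2.1.1.le, hp2.1.2.trans_le (min_le_left _ _)⟩ ⟨hp2.2.1.le, hp2.2.2⟩
  rw [e] at hp1
  have h3 : ‖u n i‖₊ ≤ K := by exact_mod_cast hp1
  exact_mod_cast h3

/-! ### Passage to the limit -/

lemma tendsto_integral_of_bounded {α ι : Type*} [MeasurableSpace α] {μ : Measure α}
    [IsFiniteMeasure μ] {l : Filter ι} [l.IsCountablyGenerated] {F : ι → α → ℝ} {f : α → ℝ} {C : ℝ}
    (hF : ∀ d, AEStronglyMeasurable (F d) μ) (hb : ∀ᶠ d in l, ∀ᵐ x ∂μ, |F d x| ≤ C)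
    (hlim : ∀ᵐ x ∂μ, Tendsto (fun d => F d x) l (𝓝 (f x))) :
    Tendsto (fun d => ∫ x, F d x ∂μ) l (𝓝 (∫ x, f x ∂μ)) :=
  tendsto_integral_filter_of_dominated_convergence (fun _ => C) (Eventually.of_forall hF) hb
    (integrable_const C) hlim

/-- A bounded family converging in `L¹` has a bounded limit, and nonlinear functionals of it
converge. -/
lemma tendsto_integral_comp_mul {α ι : Type*} [MeasurableSpace α] {μ : Measure α}
    [IsFiniteMeasure μ] {l : Filter ι} [l.NeBot] [l.IsCountablyGenerated] {f g : ι → α → ℝ}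
    {f₀ g₀ : α → ℝ} {b : ℝ → ℝ} {K A C : ℝ}
    (hf : ∀ d, Measurable (f d)) (hg : ∀ d, Measurable (g d)) (hf₀ : AEStronglyMeasurable f₀ μ)
    (hb : Continuous b) (hbK : ∀ x, |x| ≤ K → |b x| ≤ C)
    (hfK : ∀ᶠ d in l, ∀ x, |f d x| ≤ K) (hgA : ∀ d x, |g d x| ≤ A)
    (hconv : Tendsto (fun d => eLpNorm (f d - f₀) 1 μ) l (𝓝 0))
    (hgconv : ∀ x, Tendsto (fun d => g d x) l (𝓝 (g₀ x))) :
    (∀ᵐ x ∂μ, |f₀ x| ≤ K) ∧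
      Tendsto (fun d => ∫ x, b (f d x) * g d x ∂μ) l (𝓝 (∫ x, b (f₀ x) * g₀ x ∂μ)) := by
  have hsub : ∀ ns : ℕ → ι, Tendsto ns atTop l → ∃ ms : ℕ → ℕ, StrictMono ms ∧
      ∀ᵐ x ∂μ, Tendsto (fun n => f (ns (ms n)) x) atTop (𝓝 (f₀ x)) := fun ns hns =>
    (tendstoInMeasure_of_tendsto_eLpNorm one_ne_zero
      (fun n => (hf (ns n)).aestronglyMeasurable) hf₀ (hconv.comp hns)).exists_seq_tendsto_ae
  constructor
  · obtain ⟨ns, hns⟩ := exists_seq_tendsto l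
    obtain ⟨ms, hms, hae⟩ := hsub ns hns
    filter_upwards [hae] with x hx
    refine le_of_tendsto hx.abs ?_
    filter_upwards [(hns.comp hms.tendsto_atTop).eventually hfK] with n hn using hn x
  -- `L¹` convergence yields almost everywhere convergence only along subsequences; that suffices,
  -- since the limit is the same for each of them.
  · refine tendsto_of_subseq_tendsto fun ns hns => ?_
    obtain ⟨ms, hms, hae⟩ := hsub ns hns
    have hnm := hns.comp hms.tendsto_atTop
    refine ⟨ms, tendsto_integral_of_bounded (C := C * A)
      (fun n => ((hb.measurable.comp (hf _)).mul (hg _)).aestronglyMeasurable) ?_ ?_⟩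
    · filter_upwards [hnm.eventually hfK] with n hn
      refine ae_of_all _ fun x => ?_
      rw [abs_mul]
      have h1 := hbK _ (hn x)
      exact mul_le_mul h1 (hgA _ x) (abs_nonneg _) ((abs_nonneg _).trans h1)
    · filter_upwards [hae] with x hx
      exact ((hb.tendsto _).comp hx).mul ((hgconv x).comp hnm)

/-- The discrete weak formulation in integral form. -/
lemma IsFDSolution.integral_eq {θ q Δt h L T : ℝ} {M : ℕ} {u0 : ℤ → ℝ} {u : ℕ → ℤ → ℝ}
    (hθ0 : 0 < θ) (hθ1 : θ < 1) (hT : 0 < T) (hu : IsFDSolution θ q Δt h M u0 u) (hΔt : 0 < Δt)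
    (hΔt1 : Δt ≤ 1) (hh : 0 < h) (hL : L = ((M : ℝ) + 1) * h) {φ : ℝ → ℝ → ℝ}
    (hφ : IsTestFunction L T φ) {F : ℕ → ℤ → ℝ}
    (hF : ∀ n i, F n i = -(oddPow (q - 1) (u n i) *
        ((φ ((n + 1 : ℕ) * Δt) (i * h) - φ (n * Δt) (i * h)) / Δt))
          + u n i * discFracLap θ h (fun j => φ (n * Δt) (j * h)) i) :
    ∫ t in Ioo 0 (T + 1), ∫ x in Ioo (-L) L, F ⌊t / Δt⌋₊ ⌊x / h + 1 / 2⌋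
      = (∫ x in Ioo (-L) L, oddPow (q - 1) (u 0 ⌊x / h + 1 / 2⌋) * φ 0 (⌊x / h + 1 / 2⌋ * h))
        + Δt * ∫ x in Ioo (-L) L, u 0 ⌊x / h + 1 / 2⌋
          * discFracLap θ h (fun j => φ 0 (j * h)) ⌊x / h + 1 / 2⌋ := by
  have hext : ∀ n i, (M : ℤ) < |i| → u n i = 0 := fun n i hi => hu.exterior n i hi
  have hFext : ∀ n i, (M : ℤ) < |i| → F n i = 0 := fun n i hi => by
    rw [hF, hext n i hi, oddPow_zero]
    ring
  have hψ : ∀ (n : ℕ) (i : ℤ), (M : ℤ) < |i| → φ (n * Δt) (i * h) = 0 := fun n i hi => by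
    refine hφ.eq_zero fun h' => ?_
    have h1 := abs_lt.2 h'.2
    rw [abs_mul, abs_of_pos hh, hL] at h1
    have h2 := lt_of_mul_lt_mul_right h1 hh.le
    have h3 : |i| < (M : ℤ) + 1 := by exact_mod_cast h2
    omega
  have hlate : ∀ n : ℕ, ⌈T / Δt⌉₊ ≤ n → ∀ x, φ (n * Δt) x = 0 := fun n hn x => by
    refine hφ.eq_zero fun h' => absurd (show n * Δt < T from h'.1) (not_lt.2 ?_)
    have := (Nat.le_ceil (T / Δt)).trans (Nat.cast_le.2 hn)
    rwa [div_le_iff₀ hΔt] at this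
  -- The first grid time at or after `T` may exceed `T` by up to `Δt ≤ 1`, hence the interval `(0, T
  -- + 1)`.
  have hN : (⌈T / Δt⌉₊ : ℝ) * Δt ≤ T + 1 := by
    have := mul_lt_mul_of_pos_right (Nat.ceil_lt_add_one (div_nonneg hT.le hΔt.le)) hΔt
    rw [add_mul, div_mul_cancel₀ _ hΔt.ne'] at this
    linarith
  have hinner : ∀ n, ∫ x in Ioo (-L) L, F n ⌊x / h + 1 / 2⌋
      = h * ∑ i ∈ Finset.Icc (-(M : ℤ)) M, F n i := fun n => setIntegral_spaceRecon hh hL (hFext n)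
  have hsum := hu.sum_eq hθ0 hθ1 (ψ := fun n i => φ (n * Δt) (i * h)) hψ (hlate _ le_rfl <| · * h)
  have hL1 := setIntegral_spaceRecon hh hL
    (f := fun i => oddPow (q - 1) (u 0 i) * φ 0 (i * h)) fun i hi => by
      simp [hext 0 i hi, oddPow_zero]
  have hL2 := setIntegral_spaceRecon hh hL
    (f := fun i => u 0 i * discFracLap θ h (fun j => φ 0 (j * h)) i) fun i hi => by
      simp [hext 0 i hi]
  simp only [spaceRecon] at hL1 hL2
  simp only [hinner]
  rw [setIntegral_floor_div (f := fun n => h * ∑ i ∈ Finset.Icc (-(M : ℤ)) M, F n i) hΔt hN, hL1,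
    hL2, ← Finset.mul_sum]
  · simp only [hF]
    rw [hsum]
    simp only [Nat.cast_zero, zero_mul, Finset.sum_add_distrib, ← Finset.sum_div]
    field_simp
  · intro n hn
    have h1 := hlate n hn
    have h2 := hlate (n + 1) (by omega)
    simp only [hF, h1, h2]
    simp [discFracLap]

/-- The discrete weak formulation passes to the limit. The time interval is slightly enlarged, so
that it contains all time steps on which the discretized test function does not vanish. -/
lemma tendsto_weak_formulation {θ q L T : ℝ} (hθ0 : 0 < θ) (hθ1 : θ < 1) (hq : 1 < q) (hT : 0 < T)
    {D : Set (ℝ × ℝ)}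
    (hD : ∀ d ∈ D, 0 < d.1 ∧ 0 < d.2 ∧ ∃ M : ℕ, 0 < M ∧ L = ((M : ℝ) + 1) * d.2)
    (hD0 : ((0 : ℝ), (0 : ℝ)) ∈ closure D) {u0h : ℝ → ℤ → ℝ}
    (hu0h : ∀ d ∈ D, ∀ M : ℕ, L = ((M : ℝ) + 1) * d.2 → ∀ i : ℤ, (M : ℤ) < |i| → u0h d.2 i = 0)
    {U : ℝ → ℝ → ℕ → ℤ → ℝ}
    (hU : ∀ d ∈ D, ∀ M : ℕ, L = ((M : ℝ) + 1) * d.2 →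
      IsFDSolution θ q d.1 d.2 M (u0h d.2) (U d.1 d.2))
    {K : ℝ≥0}
    (hK : ∀ d ∈ D, eLpNorm (recon d.1 d.2 (U d.1 d.2)) ∞
        (volume.restrict (Ioo 0 (T + 1) ×ˢ (univ : Set ℝ))) ≤ K)
    {u : ℝ → ℝ → ℝ}
    (hu : AEStronglyMeasurable (Function.uncurry u)
      (volume.restrict (Ioi (0 : ℝ) ×ˢ (univ : Set ℝ))))
    (hconv : ∀ᵐ p ∂((volume : Measure (ℝ × ℝ)).restrict (Ioi (0 : ℝ) ×ˢ (univ : Set ℝ))),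
      Tendsto (fun d : ℝ × ℝ => recon d.1 d.2 (U d.1 d.2) p)
        (𝓝[D] ((0 : ℝ), (0 : ℝ))) (𝓝 (u p.1 p.2)))
    {u0 : ℝ → ℝ} (hu0 : AEStronglyMeasurable u0 (volume.restrict (Ioo (-L) L)))
    (hconv0 : Tendsto
      (fun d : ℝ × ℝ => eLpNorm (fun x => spaceRecon d.2 (u0h d.2) x - u0 x) 1
        (volume.restrict (Ioo (-L) L)))
      (𝓝[D] ((0 : ℝ), (0 : ℝ))) (𝓝 0))
    {φ : ℝ → ℝ → ℝ} (hφ : IsTestFunction L T φ) :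
    IntegrableOn (fun p : ℝ × ℝ => oddPow (q - 1) (u p.1 p.2) * deriv (fun s => φ s p.2) p.1)
      (Ioo 0 (T + 1) ×ˢ Ioo (-L) L) ∧
    IntegrableOn (fun p : ℝ × ℝ => u p.1 p.2 * fracLap θ (φ p.1) p.2)
      (Ioo 0 (T + 1) ×ˢ Ioo (-L) L) ∧
    IntegrableOn (fun x : ℝ => oddPow (q - 1) (u0 x) * φ 0 x) (Ioo (-L) L) ∧
    ∫ p in Ioo 0 (T + 1) ×ˢ Ioo (-L) L,
        (-(oddPow (q - 1) (u p.1 p.2) * deriv (fun s => φ s p.2) p.1)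
          + u p.1 p.2 * fracLap θ (φ p.1) p.2)
      = ∫ x in Ioo (-L) L, oddPow (q - 1) (u0 x) * φ 0 x := by
  have hr : 0 < q - 1 := by linarith
  obtain ⟨A, B, hreg⟩ := hφ.exists_isRegularFamily
  obtain ⟨C, hC0, hC⟩ := hφ.exists_lipschitz
  have hb := continuous_oddPow hr
  have hne : (𝓝[D] ((0 : ℝ), (0 : ℝ))).NeBot := mem_closure_iff_nhdsWithin_neBot.1 hD0
  set l : Filter (ℝ × ℝ) := 𝓝[D] ((0 : ℝ), (0 : ℝ)) with hl
  have hmem : ∀ᶠ d in l, d ∈ D := self_mem_nhdsWithin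
  have hfst : Tendsto (fun d : ℝ × ℝ => d.1) l (𝓝 0) :=
    (continuous_fst.tendsto ((0 : ℝ), (0 : ℝ))).mono_left nhdsWithin_le_nhds
  have hsnd : Tendsto (fun d : ℝ × ℝ => d.2) l (𝓝 0) :=
    (continuous_snd.tendsto ((0 : ℝ), (0 : ℝ))).mono_left nhdsWithin_le_nhds
  have hpos1 : ∀ᶠ d : ℝ × ℝ in l, 0 < d.1 := hmem.mono fun d hd => (hD d hd).1
  have hpos2 : ∀ᶠ d : ℝ × ℝ in l, 0 < d.2 := hmem.mono fun d hd => (hD d hd).2.1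
  have hle1 : ∀ᶠ d : ℝ × ℝ in l, d.1 ≤ 1 :=
    (hfst.eventually_lt_const one_pos).mono fun d hd => hd.le
  have hUK : ∀ d ∈ D, ∀ n : ℕ, n * d.1 < T + 1 → ∀ i, |U d.1 d.2 n i| ≤ K := fun d hd n hn i =>
    abs_le_of_eLpNorm_recon_le (hD d hd).1 (hD d hd).2.1 (hK d hd) hn i
  -- The scheme prescribes the initial values only at interior nodes; outside, both sides are zero.
  have hU0 : ∀ d ∈ D, U d.1 d.2 0 = u0h d.2 := fun d hd => by
    obtain ⟨-, -, M, -, hM⟩ := hD d hd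
    funext i
    rcases le_or_gt |i| (M : ℤ) with h | h
    · exact (hU d hd M hM).initial i h
    · rw [(hU d hd M hM).exterior 0 i h, hu0h d hd M hM i h]
  have hfloor : ∀ d ∈ D, ∀ t ∈ Ioo 0 (T + 1), (⌊t / d.1⌋₊ : ℝ) * d.1 < T + 1 := fun d hd t ht => by
    have hd1 := (hD d hd).1
    refine lt_of_le_of_lt ?_ ht.2
    rw [← le_div_iff₀ hd1]
    exact Nat.floor_le (div_nonneg ht.1.le hd1.le)
  set S : Set (ℝ × ℝ) := Ioo 0 (T + 1) ×ˢ Ioo (-L) L with hS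
  have hSm : MeasurableSet S := measurableSet_Ioo.prod measurableSet_Ioo
  have hSfin : volume S < ⊤ := by
    rw [hS, Measure.volume_eq_prod, Measure.prod_prod]
    exact ENNReal.mul_lt_top measure_Ioo_lt_top measure_Ioo_lt_top
  have : IsFiniteMeasure (volume.restrict S) := ⟨by simpa using hSfin⟩
  have hSsub : S ⊆ Ioi (0 : ℝ) ×ˢ (univ : Set ℝ) := fun p hp => ⟨hp.1.1, mem_univ _⟩
  have huS : AEStronglyMeasurable (fun p : ℝ × ℝ => u p.1 p.2) (volume.restrict S) :=
    hu.mono_measure (Measure.restrict_mono hSsub le_rfl)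
  have hconvS := ae_restrict_of_ae_restrict_of_subset hSsub hconv
  have hubd : ∀ᵐ p ∂(volume.restrict S), |u p.1 p.2| ≤ K := by
    filter_upwards [hconvS, ae_restrict_mem hSm] with p hp hpS
    refine le_of_tendsto hp.abs (hmem.mono fun d hd => ?_)
    exact hUK d hd _ (hfloor d hd _ hpS.1) _
  have hbK : ∀ x, |x| ≤ (K : ℝ) → |oddPow (q - 1) x| ≤ (K : ℝ) ^ (q - 1) := fun x hx =>
    abs_oddPow_le hr hx
  have hKr : (0 : ℝ) ≤ (K : ℝ) ^ (q - 1) := Real.rpow_nonneg K.coe_nonneg _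
  set E : ℝ := ∫ y in Ioi (0 : ℝ), 27 * B * min 1 (y ^ 2) * |levyDensity θ y| with hE
  have hI1 : IntegrableOn
      (fun p : ℝ × ℝ => oddPow (q - 1) (u p.1 p.2) * deriv (fun s => φ s p.2) p.1) S := by
    refine Integrable.of_bound ((hb.comp_aestronglyMeasurable huS).mul
      hφ.continuous_deriv.aestronglyMeasurable) ((K : ℝ) ^ (q - 1) * C) ?_
    filter_upwards [hubd] with p hp
    rw [Real.norm_eq_abs, abs_mul]
    exact mul_le_mul (hbK _ hp) (abs_deriv_le_of_lipschitz hC0 hC _ _) (abs_nonneg _) hKr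
  have hI2 : IntegrableOn (fun p : ℝ × ℝ => u p.1 p.2 * fracLap θ (φ p.1) p.2) S := by
    refine Integrable.of_bound (huS.mul
      (hreg.continuous_fracLap hθ0 hθ1).aestronglyMeasurable)
      (K * ∫ y in Ioi (0 : ℝ), B * min 1 (y ^ 2) * |levyDensity θ y|) ?_
    filter_upwards [hubd] with p hp
    rw [Real.norm_eq_abs, abs_mul]
    exact mul_le_mul hp (hreg.abs_fracLap_le hθ0 hθ1 _ _) (abs_nonneg _) K.coe_nonneg
  -- the initial datum
  have hconv0' : Tendsto (fun d : ℝ × ℝ => eLpNorm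
      ((fun x => U d.1 d.2 0 ⌊x / d.2 + 1 / 2⌋) - u0) 1 (volume.restrict (Ioo (-L) L))) l (𝓝 0) := by
    refine hconv0.congr' (hmem.mono fun d hd => ?_)
    simp only [hU0 d hd]
    rfl
  have hU0K : ∀ᶠ d in l, ∀ x : ℝ, |U d.1 d.2 0 ⌊x / d.2 + 1 / 2⌋| ≤ K := hmem.mono fun d hd x =>
    hUK d hd 0 (by simp; linarith) _
  obtain ⟨hu0bd, hlim0⟩ := tendsto_integral_comp_mul
    (f := fun (d : ℝ × ℝ) x => U d.1 d.2 0 ⌊x / d.2 + 1 / 2⌋)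
    (g := fun (d : ℝ × ℝ) x => φ 0 (⌊x / d.2 + 1 / 2⌋ * d.2)) (g₀ := φ 0)
    (fun d => measurable_comp_round d.2 _)
    (fun d => measurable_comp_round d.2 fun i => φ 0 (i * d.2)) hu0 hb hbK hU0K
    (fun d x => hreg.bound _ _) hconv0' fun x =>
      (hreg.cont.tendsto (0, x)).comp
        (tendsto_const_nhds.prodMk_nhds (tendsto_round_div_mul hpos2 hsnd x))
  have hI3 : IntegrableOn (fun x : ℝ => oddPow (q - 1) (u0 x) * φ 0 x) (Ioo (-L) L) := by
    refine Integrable.of_bound ((hb.comp_aestronglyMeasurable hu0).mul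
      (hreg.cont.comp (by fun_prop : Continuous fun x : ℝ => ((0 : ℝ), x))).aestronglyMeasurable)
      ((K : ℝ) ^ (q - 1) * A) ?_
    filter_upwards [hu0bd] with x hx
    rw [Real.norm_eq_abs, abs_mul]
    exact mul_le_mul (hbK _ hx) (hreg.bound _ _) (abs_nonneg _) hKr
  refine ⟨hI1, hI2, hI3, ?_⟩
  -- the space-time integral
  set F : ℝ × ℝ → ℕ → ℤ → ℝ := fun d n i => -(oddPow (q - 1) (U d.1 d.2 n i) *
        ((φ ((n + 1 : ℕ) * d.1) (i * d.2) - φ (n * d.1) (i * d.2)) / d.1))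
          + U d.1 d.2 n i * discFracLap θ d.2 (fun j => φ (n * d.1) (j * d.2)) i with hF
  have hFbd : ∀ d ∈ D, ∀ p ∈ S, |F d ⌊p.1 / d.1⌋₊ ⌊p.2 / d.2 + 1 / 2⌋|
      ≤ (K : ℝ) ^ (q - 1) * C + K * E := by
    intro d hd p hp
    have hd1 := (hD d hd).1
    have h1 := hUK d hd _ (hfloor d hd _ hp.1) ⌊p.2 / d.2 + 1 / 2⌋
    refine (abs_add_le _ _).trans (add_le_add ?_ ?_)
    · rw [abs_neg, abs_mul, abs_div, abs_of_pos hd1]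
      refine mul_le_mul (hbK _ h1) ?_ (by positivity) hKr
      rw [div_le_iff₀ hd1]
      refine (hC _ _ _).trans (le_of_eq ?_)
      push_cast
      rw [add_mul, one_mul, add_sub_cancel_left, abs_of_pos hd1]
    · rw [abs_mul]
      exact mul_le_mul h1 (hreg.abs_discFracLap_le hθ0 hθ1 (hD d hd).2.1 _ _) (abs_nonneg _)
        K.coe_nonneg
  have hFm : ∀ d, Measurable fun p : ℝ × ℝ => F d ⌊p.1 / d.1⌋₊ ⌊p.2 / d.2 + 1 / 2⌋ := fun d =>
    measurable_comp_floor_round d.1 d.2 (F d)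
  -- Pointwise, the difference quotient and the discrete Laplacian are evaluated at the grid point
  -- of the cell containing `p`, which tends to `p`.
  have hlimS : Tendsto (fun d : ℝ × ℝ => ∫ p in S, F d ⌊p.1 / d.1⌋₊ ⌊p.2 / d.2 + 1 / 2⌋) l
      (𝓝 (∫ p in S, (-(oddPow (q - 1) (u p.1 p.2) * deriv (fun s => φ s p.2) p.1)
          + u p.1 p.2 * fracLap θ (φ p.1) p.2))) := by
    refine tendsto_integral_of_bounded (fun d => (hFm d).aestronglyMeasurable)
      (hmem.mono fun d hd => (ae_restrict_mem hSm).mono (hFbd d hd)) ?_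
    filter_upwards [hconvS, ae_restrict_mem hSm] with p hp hpS
    have hτ := tendsto_floor_div_mul hpos1 hfst hpS.1.1.le
    have hξ := tendsto_round_div_mul hpos2 hsnd p.2
    have hσ : Tendsto (fun d : ℝ × ℝ => ((⌊p.1 / d.1⌋₊ + 1 : ℕ) : ℝ) * d.1) l (𝓝 p.1) := by
      have := hτ.add hfst
      rw [add_zero] at this
      refine this.congr fun d => ?_
      push_cast
      ring
    exact ((((hb.tendsto _).comp hp).mul (hφ.tendsto_slope (fun d => by push_cast; ring) hσ hτ hξ
      hpos1)).neg).add (hp.mul (hreg.tendsto_discFracLap hθ0 hθ1 hpos2 hsnd hτ hξ))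
  have heq : ∀ᶠ d in l, ∫ p in S, F d ⌊p.1 / d.1⌋₊ ⌊p.2 / d.2 + 1 / 2⌋
      = (∫ x in Ioo (-L) L, oddPow (q - 1) (U d.1 d.2 0 ⌊x / d.2 + 1 / 2⌋)
          * φ 0 (⌊x / d.2 + 1 / 2⌋ * d.2))
        + d.1 * ∫ x in Ioo (-L) L, U d.1 d.2 0 ⌊x / d.2 + 1 / 2⌋
          * discFracLap θ d.2 (fun j => φ 0 (j * d.2)) ⌊x / d.2 + 1 / 2⌋ := by
    filter_upwards [hmem, hle1] with d hd hd1
    obtain ⟨h1, h2, M, -, hM⟩ := hD d hd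
    rw [← (hU d hd M hM).integral_eq hθ0 hθ1 hT h1 hd1 h2 hM hφ (F := F d) fun n i => rfl]
    refine setIntegral_prod _ ?_
    refine Integrable.of_bound (hFm d).aestronglyMeasurable ((K : ℝ) ^ (q - 1) * C + K * E) ?_
    exact (ae_restrict_mem hSm).mono (hFbd d hd)
  -- The extra initial term left by the implicit time step is `O(Δt)`, since the discrete Laplacian
  -- of `φ` is bounded uniformly in `h`.
  have hsmall : Tendsto (fun d : ℝ × ℝ => d.1 * ∫ x in Ioo (-L) L, U d.1 d.2 0 ⌊x / d.2 + 1 / 2⌋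
      * discFracLap θ d.2 (fun j => φ 0 (j * d.2)) ⌊x / d.2 + 1 / 2⌋) l (𝓝 0) := by
    have h1 : Tendsto (fun d : ℝ × ℝ => |d.1| * (K * E * volume.real (Ioo (-L) L))) l (𝓝 0) := by
      simpa using hfst.abs.mul_const (K * E * volume.real (Ioo (-L) L))
    refine squeeze_zero_norm' ?_ h1
    filter_upwards [hU0K, hpos2] with d hd hd2
    rw [norm_mul, Real.norm_eq_abs]
    refine mul_le_mul_of_nonneg_left ?_ (abs_nonneg _)
    refine norm_setIntegral_le_of_norm_le_const (by simp) fun x _ => ?_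
    rw [Real.norm_eq_abs, abs_mul]
    exact mul_le_mul (hd x) (hreg.abs_discFracLap_le hθ0 hθ1 hd2 _ _) (abs_nonneg _) K.coe_nonneg
  have hfin := (hlim0.add hsmall).congr' (heq.mono fun d hd => hd.symm)
  rw [add_zero] at hfin
  exact tendsto_nhds_unique hlimS hfin

end FracDiffusion

theorem mainTheorem5 (θ q L : ℝ) (hθ0 : 0 < θ) (hθ1 : θ < 1) (hq : 1 < q) (hL : 0 < L)
    -- the discretization parameters `(Δt, h)` in use: an arbitrary set of admissible pairs
    -- accumulating at `(0, 0)`, for instance the set of all admissible pairs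
    (D : Set (ℝ × ℝ))
    (hD : ∀ d ∈ D, 0 < d.1 ∧ 0 < d.2 ∧ ∃ M : ℕ, 0 < M ∧ L = ((M : ℝ) + 1) * d.2)
    (hD0 : ((0 : ℝ), (0 : ℝ)) ∈ closure D)
    -- discrete initial data, indexed by `h`, vanishing outside the domain
    (u0h : ℝ → ℤ → ℝ)
    (hu0h : ∀ d ∈ D, ∀ M : ℕ, L = ((M : ℝ) + 1) * d.2 → ∀ i : ℤ, (M : ℤ) < |i| → u0h d.2 i = 0)
    -- solutions of the scheme, indexed by `Δt` and `h`
    (U : ℝ → ℝ → ℕ → ℤ → ℝ)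
    (hU : ∀ d ∈ D, ∀ M : ℕ, L = ((M : ℝ) + 1) * d.2 →
      FracDiffusion.IsFDSolution θ q d.1 d.2 M (u0h d.2) (U d.1 d.2))
    (hbdd : ∀ T : ℝ, 0 < T → ∃ K : ℝ≥0, ∀ d ∈ D,
      eLpNorm (FracDiffusion.recon d.1 d.2 (U d.1 d.2)) ∞
        (volume.restrict (Ioo 0 T ×ˢ (univ : Set ℝ))) ≤ K)
    (u : ℝ → ℝ → ℝ)
    (hu : MemLp (Function.uncurry u) ∞ (volume.restrict (Ioi (0 : ℝ) ×ˢ (univ : Set ℝ))))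
    (hconv : ∀ᵐ p ∂((volume : Measure (ℝ × ℝ)).restrict (Ioi (0 : ℝ) ×ˢ (univ : Set ℝ))),
      Tendsto (fun d : ℝ × ℝ => FracDiffusion.recon d.1 d.2 (U d.1 d.2) p)
        (𝓝[D] ((0 : ℝ), (0 : ℝ))) (𝓝 (u p.1 p.2)))
    (u0 : ℝ → ℝ) (hu0 : MemLp u0 1 (volume.restrict (Ioo (-L) L)))
    (hconv0 : Tendsto
      (fun d : ℝ × ℝ => eLpNorm (fun x => FracDiffusion.spaceRecon d.2 (u0h d.2) x - u0 x) 1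
        (volume.restrict (Ioo (-L) L)))
      (𝓝[D] ((0 : ℝ), (0 : ℝ))) (𝓝 0)) :
    FracDiffusion.IsWeakSolution θ q L u0 u ∧
      ∀ᵐ p ∂((volume : Measure (ℝ × ℝ)).restrict (Ioi (0 : ℝ) ×ˢ (Ioo (-L) L)ᶜ)),
        u p.1 p.2 = 0 := by
  have := mem_closure_iff_nhdsWithin_neBot.1 hD0
  constructor
  · intro T hT φ hφ
    obtain ⟨K, hK⟩ := hbdd (T + 1) (by linarith)
    obtain ⟨h1, h2, h3, h4⟩ := FracDiffusion.tendsto_weak_formulation hθ0 hθ1 hq hT hD hD0 hu0h hU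
      hK hu.1 hconv hu0.1 hconv0 hφ
    have hsub : Ioo 0 T ×ˢ Ioo (-L) L ⊆ Ioo 0 (T + 1) ×ˢ Ioo (-L) L :=
      prod_mono (Ioo_subset_Ioo_right (by linarith)) le_rfl
    have h1' := h1.mono_set hsub
    have h2' := h2.mono_set hsub
    have h1n : IntegrableOn (fun p : ℝ × ℝ =>
        -(FracDiffusion.oddPow (q - 1) (u p.1 p.2) * deriv (fun s => φ s p.2) p.1))
        (Ioo 0 T ×ˢ Ioo (-L) L) := h1'.neg
    refine ⟨h1', h2', h3, ?_⟩
    -- Back from `(0, T + 1)` to `(0, T)`: the time derivative and the fractional Laplacian of `φ`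
    -- both vanish for `t ≥ T`. Fubini then gives the iterated integrals.
    rw [setIntegral_eq_of_subset_of_forall_sdiff_eq_zero
      (measurableSet_Ioo.prod measurableSet_Ioo) hsub, integral_add h1n h2', integral_neg] at h4
    · rw [Measure.volume_eq_prod] at h1' h2' h4
      rw [setIntegral_prod _ h1', setIntegral_prod _ h2'] at h4
      linarith
    · intro p hp
      have hpT : T ≤ p.1 := by
        by_contra h
        exact hp.2 ⟨⟨hp.1.1.1, not_le.1 h⟩, hp.1.2⟩
      rw [hφ.deriv_eq_zero hpT, hφ.fracLap_eq_zero hpT]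
      ring
  · have hsub : Ioi (0 : ℝ) ×ˢ (Ioo (-L) L)ᶜ ⊆ Ioi (0 : ℝ) ×ˢ (univ : Set ℝ) :=
      prod_mono le_rfl (subset_univ _)
    filter_upwards [ae_restrict_of_ae_restrict_of_subset hsub hconv,
      ae_restrict_mem (measurableSet_Ioi.prod measurableSet_Ioo.compl)] with p hp hpS
    -- Outside `I` every reconstruction with parameters in `D` is identically zero, hence so is its
    -- limit.
    refine tendsto_nhds_unique (hp.congr' ?_) tendsto_const_nhds
    filter_upwards [self_mem_nhdsWithin] with d hd
    obtain ⟨-, hd2, M, -, hM⟩ := hD d hd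
    exact FracDiffusion.spaceRecon_eq_zero hd2 hM (fun i hi => (hU d hd M hM).exterior _ i hi) hpS.2
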